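/- **Setting.** Consider the system $x_{t+1}=Ax_t+B_uu_t+B_ww_t$, $t\in\mathbb Z$, with real matrices, $x_t\in\mathbb R^{d_x}$, $u_t\in\mathbb R^{d_u}$, a scalar disturbance $w_t$ ($d_w=1$), and the stage cost $x_t^\top Qx_t+u_t^\top Ru_t$ with $Q,R\succ0$. Assume that $(A,B_u)$ and $(A,B_w)$ are stabilizable. Block Laurent operators are identified with their transfer functions on the unit circle, $L_p$ is taken with respect to $d\omega/2\pi$, and $H_p\subset L_p$ is the subspace of causal transfer functions $\sum_{t\ge0}\widehat X_t\,e^{-j\omega t}$. For $X\in L_2$, $\{X\}_-$ is its strictly anticausal part $\sum_{n\ge1}\widehat X_{-n}\,e^{j\omega n}$. Let $F(z)=(zI-A)^{-1}B_u$ and $G(z)=(zI-A)^{-1}B_w$, and assume that they are bounded causal operators, $F,G\in H_\infty$. For a controller $K\in H_\infty$ put $T_K=\begin{bmatrix}Q^{1/2}(FK+G)\\ R^{1/2}K\end{bmatrix}$, so that $T_K^*T_K=(FK+G)^*Q(FK+G)+K^*RK$. Let $\gamma_\infty=\inf_{K\in H_\infty}\|T_K\|_{\infty}$ and $K_\circ=-(R+F^*QF)^{-1}F^*QG$.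 Let $\Delta$ be the causal and causally invertible spectral factor of $R+F^*QF$, that is $\Delta,\Delta^{-1}\in H_\infty$ and $\Delta^*\Delta=R+F^*QF$, normalised by $\Delta(\infty)\succ0$. Let $P\succ0$ be the stabilizing solution of $$P=Q+A^\top PA-A^\top PB_u(R+B_u^\top PB_u)^{-1}B_u^\top PA,$$ that is, with $K_{\rm lqr}=(R+B_u^\top PB_u)^{-1}B_u^\top PA$ all eigenvalues of $A-B_uK_{\rm lqr}$ lie in the open unit disc. Put $$\overline A=(A-B_uK_{\rm lqr})^\top,\qquad \overline C=-(R+B_u^\top PB_u)^{-\top/2}B_u^\top,\qquad \overline D=(A-B_uK_{\rm lqr})^\top PB_w,$$ with the positive definite square root. Let $\gamma>\gamma_\infty$ and let $(K_\gamma,\Lambda_\gamma)$ be a saddle point of $$\max_{\Lambda\in L_1,\ \Lambda\ge0}\ \min_{K\in H_\infty}\ \frac1{2\pi}\int_0^{2\pi}T_K^*T_K\,(1+\Lambda)\,d\omega-\gamma^2\,\frac1{2\pi}\int_0^{2\pi}\Lambda\,d\omega .$$ Let $L_\gamma$ be a causal and causally invertible spectral factor of $1+\Lambda_\gamma$ ($L_\gamma,L_\gamma^{-1}\in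 H_2$, $L_\gamma L_\gamma^*=1+\Lambda_\gamma$), and put $N_\gamma=L_\gamma^*L_\gamma$ and $S_{\gamma,-}=\{\Delta K_\circ L_\gamma\}_-$. **Theorem.** For almost every $\omega$, $$S_{\gamma,-}(e^{j\omega})=\overline C\,(e^{-j\omega}I-\overline A)^{-1}\,\overline B_\gamma,\qquad \overline B_\gamma=\frac1{2\pi}\int_0^{2\pi}(I-e^{j\omega}\overline A)^{-1}\,\overline D\,L_\gamma(e^{j\omega})\,d\omega .$$ The controller $K_\gamma$ is, up to almost everywhere equality, the unique minimizer of the $H_2$ norm of $T_K$ over all $K\in H_\infty$ with $\|T_K\|_\infty\le\gamma$, and for almost every $\omega$ $$K_\gamma(e^{j\omega})=K_\circ(e^{j\omega})-\Delta^{-1}(e^{j\omega})\,S_{\gamma,-}(e^{j\omega})\,L_\gamma^{-1}(e^{j\omega}).$$ Moreover, for almost every $\omega$, $T_{K_\circ}(e^{j\omega})^*T_{K_\circ}(e^{j\omega})<\gamma^2$ and $$N_\gamma(e^{j\omega})=\max\left\{\frac{S_{\gamma,-}(e^{j\omega})^*\,S_{\gamma,-}(e^{j\omega})}{\gamma^2-T_{K_\circ}(e^{j\omega})^*T_{K_\circ}(e^{j\omega})},\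 1\right\}.$$ -/

import Mathlib

open MeasureTheory
open scoped Real ENNReal Matrix

noncomputable section

/-! ### Functions on the unit circle

A (block) Laurent operator is represented by its transfer function
`ω ↦ X(e^{jω})` on the circle `ℝ / 2πℤ`, up to almost everywhere equality.  The measure is the
normalised one, `dω / 2π`.  The Fourier coefficient with index `n` is the coefficient of
`e^{jnω} = zⁿ`, so a causal operator `∑_{t ≥ 0} X̂_t z^{-t}` has only coefficients with index
`n ≤ 0`, and a strictly anticausal one only coefficients with index `n > 0`. -/

instance fact_zero_lt_two_pi : Fact (0 < 2 * π) := ⟨Real.two_pi_pos⟩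

/-- The set of frequencies, `ω` modulo `2π`. -/
abbrev Freq : Type := AddCircle (2 * π)

/-- The normalised measure `dω / 2π` on the frequencies. -/
abbrev dFreq : Measure Freq := AddCircle.haarAddCircle

/-- The point `e^{jω}` of the unit circle. -/
def expj (ω : Freq) : ℂ := (ω.toCircle : ℂ)

/-- The scalar Hardy space `H_p` of causal transfer functions with finite `L_p` norm on the unit
circle. -/
def MemHardy (p : ℝ≥0∞) (f : Freq → ℂ) : Prop :=
  MemLp f p dFreq ∧ ∀ n : ℤ, 0 < n → fourierCoeff f n = 0

/-- `H_p` for columns of transfer functions. -/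
def MemHardyVec (p : ℝ≥0∞) {m : ℕ} (f : Freq → Fin m → ℂ) : Prop :=
  ∀ i, MemHardy p (fun ω => f ω i)

/-- `H_p` for matrices of transfer functions. -/
def MemHardyMat (p : ℝ≥0∞) {m n : ℕ} (f : Freq → Matrix (Fin m) (Fin n) ℂ) : Prop :=
  ∀ i k, MemHardy p (fun ω => f ω i k)

/-- The strictly anticausal part `{f}_-` of a square integrable function `f` on the circle: the
sum, in `L²`, of the terms `f̂ₙ e^{jnω}`, `n ≥ 1`, of its Fourier series. -/
def anticausalPart (f : Freq → ℂ) : Freq → ℂ :=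
  ((∑' n : ℕ, fourierCoeff f ((n : ℤ) + 1) • fourierLp 2 ((n : ℤ) + 1) : Lp ℂ 2 dFreq) :
    Freq → ℂ)

/-- The strictly anticausal part of a column of functions, entry by entry. -/
def anticausalPartVec {m : ℕ} (f : Freq → Fin m → ℂ) : Freq → Fin m → ℂ :=
  fun ω i => anticausalPart (fun ω' => f ω' i) ω

/-- `L` is a causal and causally invertible spectral factor of the scalar spectrum `N`:
`L L^* = N`, and both `L` and `L⁻¹` are causal. -/
def IsSpectralFactor (N : Freq → ℝ) (L : Freq → ℂ) : Prop :=
  MemHardy 2 L ∧ MemHardy 2 (fun ω => (L ω)⁻¹) ∧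
    ∀ᵐ ω ∂dFreq, L ω * star (L ω) = (N ω : ℂ)

/-! ### Matrices -/

/-- A real matrix, seen as a complex one. -/
abbrev toC {m n : ℕ} (M : Matrix (Fin m) (Fin n) ℝ) : Matrix (Fin m) (Fin n) ℂ :=
  M.map Complex.ofReal

/-- All eigenvalues of the real matrix `M` lie in the open unit disc. -/
def IsSchur {n : ℕ} (M : Matrix (Fin n) (Fin n) ℝ) : Prop :=
  ∀ μ ∈ spectrum ℂ (toC M), ‖μ‖ < 1

/-- The pair `(A, B)` is stabilizable. -/
def IsStabilizable {n m : ℕ} (A : Matrix (Fin n) (Fin n) ℝ) (B : Matrix (Fin n) (Fin m) ℝ) :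
    Prop :=
  ∃ K : Matrix (Fin m) (Fin n) ℝ, IsSchur (A - B * K)

open scoped MatrixOrder in
/-- The positive semidefinite square root of a positive semidefinite real matrix. -/
def sqrtMat {n : ℕ} (M : Matrix (Fin n) (Fin n) ℝ) : Matrix (Fin n) (Fin n) ℝ :=
  CFC.sqrt M

/-! ### The control problem -/

/-- The data of the system `x_{t+1} = A x_t + B_u u_t + B_w w_t` with a scalar disturbance `w`
and the stage cost `x_tᵀ Q x_t + u_tᵀ R u_t`. -/
structure LQSystem (dx du : ℕ) where
  /-- the state matrix -/
  A : Matrix (Fin dx) (Fin dx) ℝ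
  /-- the input matrix of the control -/
  Bu : Matrix (Fin dx) (Fin du) ℝ
  /-- the input matrix of the disturbance -/
  Bw : Matrix (Fin dx) (Fin 1) ℝ
  /-- the state weight -/
  Q : Matrix (Fin dx) (Fin dx) ℝ
  /-- the control weight -/
  R : Matrix (Fin du) (Fin du) ℝ
  /-- the state weight is symmetric positive definite -/
  Q_posDef : Q.PosDef
  /-- the control weight is symmetric positive definite -/
  R_posDef : R.PosDef

namespace LQSystem

variable {dx du : ℕ} (S : LQSystem dx du)

/-- The transfer matrix `F = (e^{jω} I - A)⁻¹ B_u` from controls to states. -/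
def F (ω : Freq) : Matrix (Fin dx) (Fin du) ℂ :=
  (expj ω • (1 : Matrix (Fin dx) (Fin dx) ℂ) - toC S.A)⁻¹ * toC S.Bu

/-- The transfer matrix `G = (e^{jω} I - A)⁻¹ B_w` from disturbances to states. -/
def G (ω : Freq) : Matrix (Fin dx) (Fin 1) ℂ :=
  (expj ω • (1 : Matrix (Fin dx) (Fin dx) ℂ) - toC S.A)⁻¹ * toC S.Bw

/-- The state response `F K + G` to the scalar disturbance under the controller `K`. -/
def stateResponse (K : Freq → Fin du → ℂ) (ω : Freq) : Fin dx → ℂ :=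
  S.F ω *ᵥ K ω + fun i => S.G ω i 0

/-- `T_K(e^{jω})^* T_K(e^{jω})` for the weighted closed loop
`T_K = [Q^{1/2} (F K + G); R^{1/2} K]`; a nonnegative number, as the disturbance is scalar. -/
def gram (K : Freq → Fin du → ℂ) (ω : Freq) : ℝ :=
  (star (S.stateResponse K ω) ⬝ᵥ (toC S.Q *ᵥ S.stateResponse K ω)
    + star (K ω) ⬝ᵥ (toC S.R *ᵥ K ω)).re

/-- The squared `H_2` norm of the closed loop. -/
def sqNormH2 (K : Freq → Fin du → ℂ) : ℝ := ∫ ω, S.gram K ω ∂dFreq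

/-- The `H_∞` norm of the closed loop, the essential supremum of the largest singular value of
the column `T_K(e^{jω})`. -/
def normHInf (K : Freq → Fin du → ℂ) : ℝ≥0∞ :=
  essSup (fun ω => ENNReal.ofReal (Real.sqrt (S.gram K ω))) dFreq

/-- The optimal `H_∞` norm `γ_∞` over the bounded causal controllers. -/
def gammaInf : ℝ≥0∞ :=
  ⨅ (K : Freq → Fin du → ℂ) (_ : MemHardyVec ∞ K), S.normHInf K

/-- `K` solves the mixed `H_2 / H_∞` problem with bound `γ`. -/
def IsMixedOptimal (γ : ℝ) (K : Freq → Fin du → ℂ) : Prop :=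
  MemHardyVec ∞ K ∧ S.normHInf K ≤ ENNReal.ofReal γ ∧
    ∀ K' : Freq → Fin du → ℂ, MemHardyVec ∞ K' → S.normHInf K' ≤ ENNReal.ofReal γ →
      S.sqNormH2 K ≤ S.sqNormH2 K'

/-- The Lagrangian `tr (T_K^* T_K (I + Λ)) - γ² tr Λ`. -/
def lagrangian (γ : ℝ) (K : Freq → Fin du → ℂ) (Λ : Freq → ℝ) : ℝ :=
  (∫ ω, S.gram K ω * (1 + Λ ω) ∂dFreq) - γ ^ 2 * ∫ ω, Λ ω ∂dFreq

/-- `(K, Λ)` is a saddle point of the max-min problem for the Lagrangian over `Λ ∈ L_1`, `Λ ≥ 0`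
(maximisation) and `K ∈ H_∞` (minimisation). -/
def IsSaddlePoint (γ : ℝ) (K : Freq → Fin du → ℂ) (Λ : Freq → ℝ) : Prop :=
  MemHardyVec ∞ K ∧ Integrable Λ dFreq ∧ (∀ᵐ ω ∂dFreq, 0 ≤ Λ ω) ∧
    (∀ K' : Freq → Fin du → ℂ, MemHardyVec ∞ K' →
      S.lagrangian γ K Λ ≤ S.lagrangian γ K' Λ) ∧
    ∀ Λ' : Freq → ℝ, Integrable Λ' dFreq → (∀ᵐ ω ∂dFreq, 0 ≤ Λ' ω) →
      S.lagrangian γ K Λ' ≤ S.lagrangian γ K Λ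

/-- The matrix `R + F^* Q F` (which is `I + F^* F` when `Q` and `R` are identity matrices). -/
def controlGram (ω : Freq) : Matrix (Fin du) (Fin du) ℂ :=
  toC S.R + (S.F ω)ᴴ * toC S.Q * S.F ω

/-- The optimal noncausal controller `K_∘ = -(R + F^* Q F)⁻¹ F^* Q G`. -/
def Knc (ω : Freq) : Fin du → ℂ :=
  fun i => (-((S.controlGram ω)⁻¹ * (S.F ω)ᴴ * toC S.Q * S.G ω)) i 0

open scoped ComplexOrder in
/-- `Δ` is the causal and causally invertible spectral factor, `Δ^* Δ = R + F^* Q F`, normalised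
to be positive definite at `z = ∞`. -/
def IsCanonicalFactor (Δ : Freq → Matrix (Fin du) (Fin du) ℂ) : Prop :=
  MemHardyMat ∞ Δ ∧ MemHardyMat ∞ (fun ω => (Δ ω)⁻¹) ∧
    (∀ᵐ ω ∂dFreq, (Δ ω)ᴴ * Δ ω = S.controlGram ω) ∧
    (Matrix.of fun i k => fourierCoeff (fun ω => Δ ω i k) 0).PosDef

/-- The LQR gain `(R + B_uᵀ P B_u)⁻¹ B_uᵀ P A`. -/
def Klqr (P : Matrix (Fin dx) (Fin dx) ℝ) : Matrix (Fin du) (Fin dx) ℝ :=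
  (S.R + S.Buᵀ * P * S.Bu)⁻¹ * S.Buᵀ * P * S.A

/-- `P` is the stabilizing solution of the LQR Riccati equation. -/
def IsStabilizingRiccati (P : Matrix (Fin dx) (Fin dx) ℝ) : Prop :=
  P.PosDef ∧
    P = S.Q + S.Aᵀ * P * S.A
      - S.Aᵀ * P * S.Bu * (S.R + S.Buᵀ * P * S.Bu)⁻¹ * S.Buᵀ * P * S.A ∧
    IsSchur (S.A - S.Bu * S.Klqr P)

/-- `Ā = (A - B_u K_lqr)ᵀ`. -/
def Abar (P : Matrix (Fin dx) (Fin dx) ℝ) : Matrix (Fin dx) (Fin dx) ℝ :=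
  (S.A - S.Bu * S.Klqr P)ᵀ

/-- `C̄ = -(R + B_uᵀ P B_u)^{-T/2} B_uᵀ`. -/
def Cbar (P : Matrix (Fin dx) (Fin dx) ℝ) : Matrix (Fin du) (Fin dx) ℝ :=
  -(((sqrtMat (S.R + S.Buᵀ * P * S.Bu))⁻¹)ᵀ * S.Buᵀ)

/-- `D̄ = (A - B_u K_lqr)ᵀ P B_w`. -/
def Dbar (P : Matrix (Fin dx) (Fin dx) ℝ) : Matrix (Fin dx) (Fin 1) ℝ :=
  (S.A - S.Bu * S.Klqr P)ᵀ * P * S.Bw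

/-- `B̄ = (1/2π) ∫ (I - e^{jω} Ā)⁻¹ D̄ L(e^{jω}) dω`, an integral of a column, entry by entry. -/
def Bbar (P : Matrix (Fin dx) (Fin dx) ℝ) (L : Freq → ℂ) : Fin dx → ℂ :=
  fun i => ∫ ω, ((1 - expj ω • toC (S.Abar P))⁻¹ * toC (S.Dbar P)) i 0 * L ω ∂dFreq

/-- `S_- = {Δ K_∘ L}_-`. -/
def Sminus (Δ : Freq → Matrix (Fin du) (Fin du) ℂ) (L : Freq → ℂ) : Freq → Fin du → ℂ :=
  anticausalPartVec (fun ω => L ω • (Δ ω *ᵥ S.Knc ω))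

end LQSystem

end

/-! Everything rests on a completion of squares (`gram_eq_gram_Knc_add`): pointwise, T_K^*T_K =
T_{K_∘}^*T_{K_∘} + |Δ(K - K_∘)|².

Duality. Testing the maximisation over Λ gives T_K^*T_K ≤ γ² and (T_K^*T_K - γ²)Λ = 0 at the saddle
point (`IsSaddlePoint.ae_slack`). Hence the saddle value is the H₂ cost, K_γ is optimal, and every
other optimal controller minimises the same Lagrangian in K.

Minimisation in K. This is an H₂ problem with weight 1 + Λ = LL^*. Varying K along Δ⁻¹z^{-n}e_i
shows that each entry of Δ(K - K_∘)L is orthogonal to all z^{-n}L, n ≥ 0. Since L and L⁻¹ are in H₂,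
L is outer: the closed span of the z^{-n}L contains a nonzero constant
(`exists_const_mem_closure_span_shiftedLp`). So the residual has no coefficients of index ≤ 0, and
since ΔKL is causal, S_- = -Δ(K - K_∘)L. This determines K, which gives the controller formula and
uniqueness. It also gives S_-^*S_- = sN with s = |Δ(K - K_∘)|², and with d = γ² - T_{K_∘}^*T_{K_∘}
slackness says that either s = d, or N = 1 and s ≤ d; this is the maximum formula.

State space. The Riccati equation identifies Δ with M^{1/2}(I + K_lqr F), M = R + B_uᵀPB_u, and
splits ΔK_∘ into a causal term and C̄(z⁻¹ - Ā)⁻¹D̄. Multiplying by the causal L changes the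
anticausal part only by replacing D̄ with B̄, because the coefficients still satisfy x_{k+1} = Ā
x_k. -/

section FourierSeries

/-! ### Fourier coefficients on the circle: uniqueness and Parseval. -/

open Filter Topology

theorem expj_eq_fourier (ω : Freq) : expj ω = fourier 1 ω := fourier_one.symm

theorem norm_fourier_apply (n : ℤ) (ω : Freq) : ‖fourier n ω‖ = 1 := Circle.norm_coe _

theorem star_fourier (n : ℤ) (ω : Freq) : star (fourier n ω) = fourier (-n) ω :=
  fourier_neg.symm

theorem memLp_of_continuous {E : Type*} [NormedAddCommGroup E] [SecondCountableTopology E]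
    {f : Freq → E} (hf : Continuous f) (p : ℝ≥0∞) : MemLp f p dFreq := by
  obtain ⟨C, hC⟩ := isCompact_univ.exists_bound_of_continuousOn hf.continuousOn
  exact MemLp.of_bound hf.aestronglyMeasurable C (ae_of_all _ fun ω => hC ω trivial)

theorem fourierCoeff_fourier_mul (f : Freq → ℂ) (m n : ℤ) :
    fourierCoeff (fun ω => fourier m ω * f ω) n = fourierCoeff f (n - m) := by
  refine integral_congr_ae (ae_of_all _ fun ω => ?_)
  simp only [smul_eq_mul]
  rw [show -(n - m) = -n + m by ring, fourier_add, mul_assoc]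

theorem fourierCoeff_star (f : Freq → ℂ) (n : ℤ) :
    fourierCoeff (fun ω => star (f ω)) n = star (fourierCoeff f (-n)) := by
  unfold fourierCoeff
  rw [RCLike.star_def, ← integral_conj]
  refine integral_congr_ae (ae_of_all _ fun ω => ?_)
  simp only [smul_eq_mul, map_mul, neg_neg, fourier_neg]

theorem fourierCoeff_const (c : ℂ) (n : ℤ) :
    fourierCoeff (fun _ : Freq => c) n = if n = 0 then c else 0 := by
  have h := (orthonormal_iff_ite.1 (orthonormal_fourier (T := 2 * π))) n 0
  rw [ContinuousMap.inner_toLp] at h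
  unfold fourierCoeff
  simp only [smul_eq_mul]
  rw [integral_mul_const]
  have h' : ∫ ω, fourier (-n) ω ∂dFreq = if n = 0 then 1 else 0 := by
    rw [← h]
    refine integral_congr_ae (ae_of_all _ fun ω => ?_)
    simp only [fourier_zero, one_mul, fourier_neg]
  rw [h']
  split_ifs <;> simp

theorem fourierCoeff_sub {f g : Freq → ℂ} (hf : Integrable f dFreq) (hg : Integrable g dFreq)
    (n : ℤ) : fourierCoeff (fun ω => f ω - g ω) n = fourierCoeff f n - fourierCoeff g n := by
  unfold fourierCoeff
  rw [← integral_sub (hf.fourier_smul _) (hg.fourier_smul _)]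
  simp only [smul_sub]

theorem fourierCoeff_add_fun {f g : Freq → ℂ} (hf : Integrable f dFreq) (hg : Integrable g dFreq)
    (n : ℤ) : fourierCoeff (fun ω => f ω + g ω) n = fourierCoeff f n + fourierCoeff g n :=
  congrFun (fourierCoeff.add hf hg) n

theorem fourierCoeff_fun_sum {ι : Type*} (s : Finset ι) {f : ι → Freq → ℂ}
    (hf : ∀ i ∈ s, Integrable (f i) dFreq) (n : ℤ) :
    fourierCoeff (fun ω => ∑ i ∈ s, f i ω) n = ∑ i ∈ s, fourierCoeff (f i) n := by
  have h := congrFun (fourierCoeff.sum s f hf) n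
  rw [Finset.sum_apply] at h
  rw [← h]
  congr 1
  ext ω
  simp

/-- An integrable function that annihilates every continuous function vanishes. -/
theorem ae_eq_zero_of_integral_mul_continuous {f : Freq → ℂ} (hf : Integrable f dFreq)
    (h : ∀ g : C(Freq, ℂ), ∫ ω, g ω * f ω ∂dFreq = 0) : f =ᵐ[dFreq] 0 := by
  refine ae_eq_zero_of_forall_setIntegral_isClosed_eq_zero hf fun s hs => ?_
  have hδ : ∀ n : ℕ, (0 : ℝ) < 1 / ((n : ℝ) + 1) := fun n => by positivity
  -- Thickened indicators are continuous, bounded by 1, and converge pointwise to the indicator of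
  -- the closed set `s`, so dominated convergence passes from continuous test functions to `s`.
  have hlim := thickenedIndicator_tendsto_indicator_closure hδ
    tendsto_one_div_add_atTop_nhds_zero_nat s
  rw [hs.closure_eq, tendsto_pi_nhds] at hlim
  rw [← integral_indicator hs.measurableSet]
  have hcont : ∀ n : ℕ, Continuous fun ω : Freq =>
      (((thickenedIndicator (hδ n) s ω : NNReal) : ℝ) : ℂ) := fun n =>
    Complex.continuous_ofReal.comp (NNReal.continuous_coe.comp (thickenedIndicator (hδ n) s).continuous)
  refine tendsto_nhds_unique (f := fun n : ℕ => ∫ ω, (((thickenedIndicator (hδ n) s ω : NNReal) : ℝ) : ℂ) * f ω ∂dFreq)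
    (l := atTop) ?_ ?_
  · refine tendsto_integral_of_dominated_convergence (fun ω => ‖f ω‖) (fun n => ?_) hf.norm
      (fun n => ae_of_all _ fun ω => ?_) (ae_of_all _ fun ω => ?_)
    · exact (hcont n).aestronglyMeasurable.mul hf.aestronglyMeasurable
    · rw [norm_mul]
      refine mul_le_of_le_one_left (norm_nonneg _) ?_
      rw [Complex.norm_real, Real.norm_eq_abs, NNReal.abs_eq]
      exact_mod_cast thickenedIndicator_le_one (hδ n) s ω
    · have h1 : Tendsto (fun n : ℕ => (((thickenedIndicator (hδ n) s ω : NNReal) : ℝ) : ℂ)) atTop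
          (𝓝 (((s.indicator (fun _ => (1 : NNReal)) ω : NNReal) : ℝ) : ℂ)) :=
        (Complex.continuous_ofReal.tendsto _).comp
          ((NNReal.continuous_coe.tendsto _).comp (hlim ω))
      have h2 := h1.mul_const (f ω)
      convert h2 using 2
      by_cases hω : ω ∈ s <;> simp [hω]
  · have : (fun n : ℕ => ∫ ω, (((thickenedIndicator (hδ n) s ω : NNReal) : ℝ) : ℂ) * f ω ∂dFreq) =
        fun _ => 0 := funext fun n => h ⟨_, hcont n⟩
    rw [this]
    exact tendsto_const_nhds

/-- An integrable function on the circle with vanishing Fourier coefficients vanishes. -/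
theorem ae_eq_zero_of_fourierCoeff_eq_zero {f : Freq → ℂ} (hf : Integrable f dFreq)
    (h : ∀ n, fourierCoeff f n = 0) : f =ᵐ[dFreq] 0 := by
  refine ae_eq_zero_of_integral_mul_continuous hf fun g => ?_
  have hint : ∀ g : C(Freq, ℂ), Integrable (fun ω => g ω * f ω) dFreq := fun g =>
    hf.bdd_mul g.continuous.aestronglyMeasurable (ae_of_all _ fun ω => g.norm_coe_le_norm ω)
  let φ : C(Freq, ℂ) →ₗ[ℂ] ℂ :=
    { toFun := fun g => ∫ ω, g ω * f ω ∂dFreq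
      map_add' := fun g₁ g₂ => by
        rw [← integral_add (hint g₁) (hint g₂)]
        simp only [ContinuousMap.add_apply, add_mul]
      map_smul' := fun c g => by
        rw [RingHom.id_apply, smul_eq_mul, ← integral_const_mul]
        simp only [ContinuousMap.smul_apply, smul_eq_mul, mul_assoc] }
  have hφ : Continuous φ := by
    refine AddMonoidHomClass.continuous_of_bound φ (∫ ω, ‖f ω‖ ∂dFreq) fun g => ?_
    refine (norm_integral_le_integral_norm _).trans ?_
    rw [← integral_mul_const]
    refine integral_mono (hint g).norm (hf.norm.mul_const _) fun ω => ?_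
    simp only [norm_mul]
    rw [mul_comm]
    exact mul_le_mul_of_nonneg_left (g.norm_coe_le_norm ω) (norm_nonneg _)
  -- The functional g ↦ ∫ g f is continuous for the sup norm and kills every exponential;
  -- trigonometric polynomials are dense.
  have hle : (Submodule.span ℂ (Set.range (fourier (T := 2 * π)))).topologicalClosure ≤
      LinearMap.ker φ := by
    refine Submodule.topologicalClosure_minimal _ ?_ (isClosed_singleton.preimage hφ)
    rw [Submodule.span_le]
    rintro _ ⟨n, rfl⟩
    have := h (-n)
    rw [fourierCoeff] at this
    simpa [φ] using this
  rw [span_fourier_closure_eq_top] at hle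
  exact hle (Submodule.mem_top : g ∈ ⊤)

theorem ae_eq_of_fourierCoeff_eq {f g : Freq → ℂ} (hf : Integrable f dFreq)
    (hg : Integrable g dFreq) (h : ∀ n, fourierCoeff f n = fourierCoeff g n) : f =ᵐ[dFreq] g := by
  have := ae_eq_zero_of_fourierCoeff_eq_zero (hf.sub hg) fun n => by
    have := fourierCoeff_sub hf hg n
    rw [h n, sub_self] at this
    exact this
  filter_upwards [this] with ω hω using sub_eq_zero.1 hω

theorem inner_toLp_eq_integral {f g : Freq → ℂ} (hf : MemLp f 2 dFreq) (hg : MemLp g 2 dFreq) :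
    inner ℂ (hf.toLp f) (hg.toLp g) = ∫ ω, star (f ω) * g ω ∂dFreq := by
  rw [L2.inner_def]
  refine integral_congr_ae ?_
  filter_upwards [hf.coeFn_toLp, hg.coeFn_toLp] with ω h1 h2
  rw [h1, h2, RCLike.inner_apply, mul_comm]
  rfl

theorem inner_fourierLp (n : ℤ) (g : Lp ℂ 2 dFreq) :
    inner ℂ (fourierLp 2 n) g = fourierCoeff g n := by
  rw [← fourierBasis_repr, HilbertBasis.repr_apply_apply, coe_fourierBasis]

/-- Parseval's identity. -/
theorem hasSum_star_fourierCoeff_mul {f g : Freq → ℂ} (hf : MemLp f 2 dFreq)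
    (hg : MemLp g 2 dFreq) :
    HasSum (fun k : ℤ => star (fourierCoeff f k) * fourierCoeff g k)
      (∫ ω, star (f ω) * g ω ∂dFreq) := by
  have h := (fourierBasis (T := 2 * π)).hasSum_inner_mul_inner (hf.toLp f) (hg.toLp g)
  rw [inner_toLp_eq_integral] at h
  suffices heq : (fun k : ℤ => star (fourierCoeff f k) * fourierCoeff g k) = fun k : ℤ =>
      inner ℂ (hf.toLp f) (fourierBasis k) * inner ℂ (fourierBasis k) (hg.toLp g) from heq ▸ h
  funext k
  rw [coe_fourierBasis, inner_fourierLp, ← inner_conj_symm, inner_fourierLp,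
    fourierCoeff_congr_ae hf.coeFn_toLp, fourierCoeff_congr_ae hg.coeFn_toLp]
  rfl

end FourierSeries

/-! ### Scalar Hardy spaces and the strictly anticausal part. -/

section Hardy

theorem MeasureTheory.MemLp.integrable_two {f : Freq → ℂ} (hf : MemLp f 2 dFreq) : Integrable f dFreq :=
  hf.integrable (by norm_num)

theorem MeasureTheory.MemLp.mul_top {f g : Freq → ℂ} {p : ℝ≥0∞} (hf : MemLp f ∞ dFreq) (hg : MemLp g p dFreq) :
    MemLp (fun ω => f ω * g ω) p dFreq :=
  MemLp.mul hg hf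

theorem MeasureTheory.MemLp.mul_two {f g : Freq → ℂ} (hf : MemLp f 2 dFreq) (hg : MemLp g 2 dFreq) :
    Integrable (fun ω => f ω * g ω) dFreq :=
  hf.integrable_mul hg

theorem memLp_fourier (n : ℤ) (p : ℝ≥0∞) : MemLp (fun ω : Freq => fourier n ω) p dFreq :=
  memLp_of_continuous (fourier n).continuous p

theorem MeasureTheory.MemLp.star_fun {f : Freq → ℂ} {p : ℝ≥0∞} (hf : MemLp f p dFreq) :
    MemLp (fun ω => star (f ω)) p dFreq :=
  hf.star

/-- The product of two square integrable causal functions is causal. -/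
theorem fourierCoeff_mul_eq_zero {f g : Freq → ℂ} (hf : MemHardy 2 f) (hg : MemHardy 2 g)
    {n : ℤ} (hn : 0 < n) : fourierCoeff (fun ω => f ω * g ω) n = 0 := by
  have h := hasSum_star_fourierCoeff_mul hf.1.star_fun ((memLp_fourier (-n) ∞).mul_top hg.1)
  -- The k-th Parseval term is f̂(-k) ĝ(k + n). As n > 0, one of the indices -k and k + n is always
  -- positive, so every term vanishes.
  have h0 : (fun k : ℤ => star (fourierCoeff (fun ω => star (f ω)) k) *
      fourierCoeff (fun ω => fourier (-n) ω * g ω) k) = fun _ => 0 := by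
    funext k
    rw [fourierCoeff_star, fourierCoeff_fourier_mul, star_star]
    by_cases hk : k < 0
    · rw [hf.2 (-k) (by lia), zero_mul]
    · rw [hg.2 (k - -n) (by lia), mul_zero]
  rw [h0] at h
  rw [fourierCoeff, ← h.unique hasSum_zero]
  refine integral_congr_ae (ae_of_all _ fun ω => ?_)
  simp only [star_star, smul_eq_mul]
  ring

theorem MemHardy.mono {f : Freq → ℂ} {p q : ℝ≥0∞} (hf : MemHardy q f) (h : p ≤ q) :
    MemHardy p f :=
  ⟨hf.1.mono_exponent h, hf.2⟩

theorem MemHardy.two {f : Freq → ℂ} (hf : MemHardy ∞ f) : MemHardy 2 f := hf.mono le_top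

theorem MemHardy.mul_two {f g : Freq → ℂ} (hf : MemHardy ∞ f) (hg : MemHardy 2 g) :
    MemHardy 2 (fun ω => f ω * g ω) :=
  ⟨hf.1.mul_top hg.1, fun _ hn => fourierCoeff_mul_eq_zero hf.two hg hn⟩

theorem MemHardy.mul {f g : Freq → ℂ} (hf : MemHardy ∞ f) (hg : MemHardy ∞ g) :
    MemHardy ∞ (fun ω => f ω * g ω) :=
  ⟨hf.1.mul_top hg.1, fun _ hn => fourierCoeff_mul_eq_zero hf.two hg.two hn⟩

theorem MemHardy.integrable {f : Freq → ℂ} {p : ℝ≥0∞} (hf : MemHardy p f) (hp : 1 ≤ p) :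
    Integrable f dFreq :=
  hf.1.integrable hp

theorem memHardy_const (c : ℂ) (p : ℝ≥0∞) : MemHardy p (fun _ => c) :=
  ⟨memLp_const c, fun n hn => by rw [fourierCoeff_const, if_neg hn.ne']⟩

theorem memHardy_fourier_neg (n : ℕ) (p : ℝ≥0∞) :
    MemHardy p (fun ω : Freq => fourier (-(n : ℤ)) ω) := by
  refine ⟨memLp_fourier _ _, fun m hm => ?_⟩
  have := fourierCoeff_fourier_mul (fun _ => 1) (-(n : ℤ)) m
  simp only [mul_one] at this
  rw [this, fourierCoeff_const, if_neg (by lia)]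

theorem MemHardy.add {f g : Freq → ℂ} {p : ℝ≥0∞} (hp : 1 ≤ p) (hf : MemHardy p f)
    (hg : MemHardy p g) : MemHardy p (fun ω => f ω + g ω) :=
  ⟨hf.1.add hg.1, fun n hn => by
    rw [fourierCoeff_add_fun (hf.integrable hp) (hg.integrable hp), hf.2 n hn, hg.2 n hn,
      add_zero]⟩

theorem MemHardy.const_mul {f : Freq → ℂ} {p : ℝ≥0∞} (c : ℂ) (hf : MemHardy p f) :
    MemHardy p (fun ω => c * f ω) :=
  ⟨hf.1.const_mul c, fun n hn => by rw [fourierCoeff.const_mul, hf.2 n hn, mul_zero]⟩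

theorem MemHardy.sum {ι : Type*} (s : Finset ι) {f : ι → Freq → ℂ} {p : ℝ≥0∞} (hp : 1 ≤ p)
    (hf : ∀ i ∈ s, MemHardy p (f i)) : MemHardy p (fun ω => ∑ i ∈ s, f i ω) :=
  ⟨memLp_finsetSum s fun i hi => (hf i hi).1, fun n hn => by
    rw [fourierCoeff_fun_sum s fun i hi => (hf i hi).integrable hp]
    exact Finset.sum_eq_zero fun i hi => (hf i hi).2 n hn⟩

theorem MemHardy.congr {f g : Freq → ℂ} {p : ℝ≥0∞} (hf : MemHardy p f) (h : f =ᵐ[dFreq] g) :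
    MemHardy p g :=
  ⟨hf.1.ae_eq h, fun n hn => by rw [← fourierCoeff_congr_ae h, hf.2 n hn]⟩

/-- A function that is both causal and anticausal is constant. -/
theorem ae_eq_const_of_memHardy_star {f : Freq → ℂ} {p : ℝ≥0∞} (hp : 1 ≤ p) (hf : MemHardy p f)
    (hf' : ∀ n : ℤ, 0 < n → fourierCoeff (fun ω => star (f ω)) n = 0) :
    f =ᵐ[dFreq] fun _ => fourierCoeff f 0 := by
  refine ae_eq_of_fourierCoeff_eq (hf.integrable hp) (integrable_const _) fun n => ?_
  rw [fourierCoeff_const]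
  split_ifs with h
  · rw [h]
  · rcases lt_or_gt_of_ne h with h | h
    · have := hf' (-n) (by lia)
      rwa [fourierCoeff_star, neg_neg, star_eq_zero] at this
    · exact hf.2 n h

/-- The series that defines `anticausalPart` is a `tsum`, with a default value if it diverges. A
square integrable candidate with the right coefficients shows that it converges and to what, so
nothing is needed of `f` itself. -/
theorem anticausalPart_ae_eq {f g : Freq → ℂ} (hg : MemLp g 2 dFreq)
    (h : ∀ n : ℤ, 0 < n → fourierCoeff g n = fourierCoeff f n)
    (h' : ∀ n : ℤ, n ≤ 0 → fourierCoeff g n = 0) : anticausalPart f =ᵐ[dFreq] g := by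
  have hs := hasSum_fourier_series_L2 (hg.toLp g)
  have hinj : Function.Injective fun n : ℕ => (n : ℤ) + 1 := fun a b hab => by
    simpa using hab
  rw [← hinj.hasSum_iff] at hs
  · have hs' : HasSum (fun n : ℕ => fourierCoeff f ((n : ℤ) + 1) •
        (fourierLp 2 ((n : ℤ) + 1) : Lp ℂ 2 dFreq)) (hg.toLp g) := by
      convert hs using 2 with n
      simp only [Function.comp]
      rw [fourierCoeff_congr_ae hg.coeFn_toLp, h _ (by lia)]
    unfold anticausalPart
    rw [hs'.tsum_eq]
    exact hg.coeFn_toLp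
  · intro n hn
    have : n ≤ 0 := by
      by_contra hlt
      exact hn ⟨(n - 1).toNat, by simp; lia⟩
    rw [fourierCoeff_congr_ae hg.coeFn_toLp, h' n this, zero_smul]

end Hardy

/-! ### A function that lies in H₂ together with its inverse is outer. -/

section Outer

/-- The element `z^{-n} L` of `L²`. -/
noncomputable def shiftedLp {L : Freq → ℂ} (hL : MemLp L 2 dFreq) (n : ℕ) : Lp ℂ 2 dFreq :=
  ((memLp_fourier (-(n : ℤ)) ∞).mul_top hL).toLp _

theorem inner_shiftedLp {L g : Freq → ℂ} (hL : MemLp L 2 dFreq) (hg : MemLp g 2 dFreq) (n : ℕ) :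
    inner ℂ (shiftedLp hL n) (hg.toLp g) =
      ∫ ω, star (fourier (-(n : ℤ)) ω * L ω) * g ω ∂dFreq :=
  inner_toLp_eq_integral _ _

theorem inner_eq_zero_of_mem_closure_span {ι : Type*} {v : ι → Lp ℂ 2 dFreq} {x w : Lp ℂ 2 dFreq}
    (hx : ∀ i, inner ℂ x (v i) = 0)
    (hw : w ∈ (Submodule.span ℂ (Set.range v)).topologicalClosure) : inner ℂ x w = 0 := by
  have hle : (Submodule.span ℂ (Set.range v)).topologicalClosure ≤
      LinearMap.ker (innerSL ℂ x).toLinearMap := by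
    refine Submodule.topologicalClosure_minimal _ ?_
      (isClosed_singleton.preimage (innerSL ℂ x).continuous)
    rw [Submodule.span_le]
    rintro _ ⟨i, rfl⟩
    exact hx i
  exact hle hw

/-- If `L` and `L⁻¹` belong to `H₂`, `θ ∈ H₂`, and both `|θ|²` and `θ^* L` are causal, then `θ` is
constant. -/
theorem ae_eq_const_of_star_mul_causal {L θ : Freq → ℂ} (hL : MemHardy 2 L)
    (hL' : MemHardy 2 fun ω => (L ω)⁻¹) (h0 : ∀ᵐ ω ∂dFreq, L ω ≠ 0) (hθ : MemHardy 2 θ)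
    (hpos : ∀ m : ℤ, 0 < m → fourierCoeff (fun ω => star (θ ω) * θ ω) m = 0)
    (horth : ∀ m : ℤ, 0 < m → fourierCoeff (fun ω => star (θ ω) * L ω) m = 0) :
    θ =ᵐ[dFreq] fun _ => fourierCoeff θ 0 := by
  have hint : Integrable (fun ω => star (θ ω) * θ ω) dFreq := hθ.1.star_fun.mul_two hθ.1
  have hself : (fun ω => star (star (θ ω) * θ ω)) = fun ω => star (θ ω) * θ ω := by
    funext ω
    rw [star_mul, star_star]
  -- |θ|² is real, so its negative coefficients vanish with the positive ones. Thus |θ| is constant,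
  -- and θ is bounded.
  have hsq := ae_eq_const_of_memHardy_star le_rfl ⟨memLp_one_iff_integrable.2 hint, hpos⟩
    (by rw [hself]; exact hpos)
  generalize fourierCoeff (fun ω => star (θ ω) * θ ω) 0 = c at hsq
  have hθtop : MemLp θ ∞ dFreq := by
    refine MemLp.of_bound hθ.1.1 (Real.sqrt ‖c‖) ?_
    filter_upwards [hsq] with ω hω
    refine Real.le_sqrt_of_sq_le ?_
    rw [← hω, norm_mul, norm_star, sq]
  have hφ : MemHardy 2 (fun ω => star (θ ω) * L ω) := ⟨hθtop.star_fun.mul_top hL.1, horth⟩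
  -- θ^* = (θ^*L)L⁻¹ is a product of two functions in H₂, so θ^* is causal as well as θ.
  refine ae_eq_const_of_memHardy_star (by norm_num) hθ fun m hm => ?_
  rw [← fourierCoeff_mul_eq_zero hφ hL' hm]
  refine congrFun (fourierCoeff_congr_ae ?_) m
  filter_upwards [h0] with ω hω
  rw [mul_assoc, mul_inv_cancel₀ hω, mul_one]

/-- If both `L` and `L⁻¹` belong to `H₂`, then the closed span of the functions `z^{-n} L`, `n ≥ 0`,
contains a nonzero constant. -/
theorem exists_const_mem_closure_span_shiftedLp {L : Freq → ℂ} (hL : MemHardy 2 L)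
    (hL' : MemHardy 2 fun ω => (L ω)⁻¹) (h0 : ∀ᵐ ω ∂dFreq, L ω ≠ 0) :
    ∃ a : ℂ, a ≠ 0 ∧ (memLp_const a).toLp (fun _ : Freq => a) ∈
      (Submodule.span ℂ (Set.range (shiftedLp hL.1))).topologicalClosure := by
  set M := (Submodule.span ℂ (Set.range (shiftedLp hL.1))).topologicalClosure with hM
  set M₁ := (Submodule.span ℂ
    (Set.range fun n : ℕ => shiftedLp hL.1 (n + 1))).topologicalClosure with hM₁
  have hsub : M₁ ≤ M := Submodule.topologicalClosure_mono
    (Submodule.span_mono (by rintro _ ⟨n, rfl⟩; exact ⟨n + 1, rfl⟩))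
  have : CompleteSpace M₁ := (Submodule.isClosed_topologicalClosure _).completeSpace_coe
  -- Wold decomposition: θ is the part of L orthogonal to the span of its proper shifts z^{-n}L, n ≥
  -- 1. It will turn out to be the wanted constant.
  set v₀ := shiftedLp hL.1 0 with hv₀
  set p := M₁.starProjection v₀ with hp
  have hpM₁ : p ∈ M₁ := Submodule.starProjection_apply_mem _ _
  set θ : Lp ℂ 2 dFreq := v₀ - p with hθ
  have hθL : MemLp (θ : Freq → ℂ) 2 dFreq := Lp.memLp θ
  have htoLp : hθL.toLp _ = θ := Lp.toLp_coeFn θ _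
  have hθM : θ ∈ M := M.sub_mem
    (Submodule.le_topologicalClosure _ (Submodule.subset_span ⟨0, rfl⟩)) (hsub hpM₁)
  have hθorth : ∀ n : ℕ, ∫ ω, star (fourier (-((n : ℤ) + 1)) ω * L ω) * θ ω ∂dFreq = 0 := by
    intro n
    have h := (M₁.mem_orthogonal θ).1 (Submodule.sub_starProjection_mem_orthogonal v₀)
      (shiftedLp hL.1 (n + 1)) (Submodule.le_topologicalClosure _ (Submodule.subset_span ⟨n, rfl⟩))
    rw [← htoLp, inner_shiftedLp] at h
    exact_mod_cast h
  have hcoefv : ∀ n : ℕ, ∀ m : ℤ,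
      fourierCoeff (shiftedLp hL.1 n) m = fourierCoeff L (m + n) := by
    intro n m
    rw [shiftedLp, fourierCoeff_congr_ae (MemLp.coeFn_toLp _), fourierCoeff_fourier_mul,
      sub_neg_eq_add]
  have hθcausal : ∀ m : ℤ, 0 < m → fourierCoeff θ m = 0 := by
    intro m hm
    rw [← inner_fourierLp]
    refine inner_eq_zero_of_mem_closure_span (fun n => ?_) hθM
    rw [inner_fourierLp, hcoefv]
    exact hL.2 _ (by lia)
  -- For m > 0, the inner product of z^{-n}L with z^mθ is that of z^{-n-m}L with θ, hence zero. So
  -- z^mθ is orthogonal to `M`, which contains θ.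
  have hpos : ∀ m : ℤ, 0 < m → fourierCoeff (fun ω => star (θ ω) * θ ω) m = 0 := by
    intro m hm
    have hx := (memLp_fourier m ∞).mul_top hθL
    have h : inner ℂ (hx.toLp _) (hθL.toLp _) = 0 := by
      refine inner_eq_zero_of_mem_closure_span (fun n => ?_) (htoLp ▸ hθM)
      rw [← inner_conj_symm, inner_shiftedLp, map_eq_zero, ← hθorth (n + m.toNat - 1)]
      refine integral_congr_ae (ae_of_all _ fun ω => ?_)
      have : -(((n + m.toNat - 1 : ℕ) : ℤ) + 1) = -(n : ℤ) + -m := by lia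
      simp only [this, fourier_add, star_mul', star_fourier, neg_neg]
      ring
    rw [inner_toLp_eq_integral] at h
    rw [fourierCoeff, ← h]
    refine integral_congr_ae (ae_of_all _ fun ω => ?_)
    simp only [star_mul', star_fourier, smul_eq_mul]
    ring
  have horth : ∀ m : ℤ, 0 < m → fourierCoeff (fun ω => star (θ ω) * L ω) m = 0 := by
    intro m hm
    have h := hθorth (m.toNat - 1)
    have h3 : -(((m.toNat - 1 : ℕ) : ℤ) + 1) = -m := by lia
    rw [h3] at h
    have h4 := congrArg star h
    rw [star_zero, RCLike.star_def, ← integral_conj] at h4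
    rw [fourierCoeff, ← h4]
    refine integral_congr_ae (ae_of_all _ fun ω => ?_)
    simp only [smul_eq_mul, map_mul, RCLike.star_def, Complex.conj_conj]
    ring
  have hconst := ae_eq_const_of_star_mul_causal hL hL' h0 ⟨hθL, hθcausal⟩ hpos horth
  -- The subtracted projection lies in the closed span of the z^{-n}L with n ≥ 1, all of mean zero.
  have hzero : fourierCoeff θ 0 = fourierCoeff L 0 := by
    have hp0 : inner ℂ (fourierLp 2 0) p = 0 := by
      refine inner_eq_zero_of_mem_closure_span (fun n => ?_) hpM₁
      rw [inner_fourierLp, hcoefv]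
      exact hL.2 _ (by lia)
    rw [← inner_fourierLp, hθ, inner_sub_right, hp0, sub_zero, inner_fourierLp, hcoefv]
    simp
  refine ⟨fourierCoeff L 0, fun hL0 => ?_, ?_⟩
  -- If the mean of L vanished, zL would still be causal, and then so would zL · L⁻¹ = z.
  · have hzL : MemHardy 2 (fun ω => fourier 1 ω * L ω) := by
      refine ⟨(memLp_fourier 1 ∞).mul_top hL.1, fun n hn => ?_⟩
      rw [fourierCoeff_fourier_mul]
      rcases eq_or_lt_of_le (show (0 : ℤ) ≤ n - 1 by lia) with h | h
      · rw [← h, hL0]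
      · exact hL.2 _ h
    have h1 := fourierCoeff_mul_eq_zero hzL hL' one_pos
    have h2 : (fun ω => fourier 1 ω * L ω * (L ω)⁻¹) =ᵐ[dFreq] fun ω => fourier 1 ω * 1 := by
      filter_upwards [h0] with ω hω
      rw [mul_assoc, mul_inv_cancel₀ hω]
    rw [fourierCoeff_congr_ae h2, fourierCoeff_fourier_mul, sub_self, fourierCoeff_const,
      if_pos rfl] at h1
    exact one_ne_zero h1
  · convert hθM using 1
    rw [← htoLp, MemLp.toLp_eq_toLp_iff]
    rw [hzero] at hconst
    exact hconst.symm

/-- If both `L` and `L⁻¹` belong to `H₂`, a square integrable function that is orthogonal to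
`z^{-n} L` for all `n ≥ 0` is strictly anticausal. -/
theorem fourierCoeff_eq_zero_of_orthogonal {L E : Freq → ℂ} (hL : MemHardy 2 L)
    (hL' : MemHardy 2 fun ω => (L ω)⁻¹) (h0 : ∀ᵐ ω ∂dFreq, L ω ≠ 0) (hE : MemLp E 2 dFreq)
    (h : ∀ n : ℕ, ∫ ω, star (fourier (-(n : ℤ)) ω * L ω) * E ω ∂dFreq = 0) {m : ℤ}
    (hm : m ≤ 0) : fourierCoeff E m = 0 := by
  obtain ⟨a, ha, hmem⟩ := exists_const_mem_closure_span_shiftedLp hL hL' h0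
  have hx := (memLp_fourier (-m) ∞).mul_top hE
  -- Since m ≤ 0, z^{-m}E inherits the orthogonality to every z^{-n}L, hence is orthogonal to the
  -- constant `a`; its mean is the coefficient of E with index m.
  have h1 : inner ℂ (hx.toLp _) ((memLp_const a).toLp (fun _ : Freq => a)) = 0 := by
    refine inner_eq_zero_of_mem_closure_span (fun n => ?_) hmem
    rw [← inner_conj_symm, inner_shiftedLp, map_eq_zero, ← h (n + m.natAbs)]
    refine integral_congr_ae (ae_of_all _ fun ω => ?_)
    have : -((n + m.natAbs : ℕ) : ℤ) = -(n : ℤ) + m := by lia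
    simp only [this, fourier_add, star_mul', star_fourier, neg_neg]
    ring
  rw [← inner_conj_symm, inner_toLp_eq_integral, map_eq_zero, integral_const_mul,
    mul_eq_zero, star_eq_zero] at h1
  exact h1.resolve_left ha

end Outer

/-! ### Hardy spaces of matrices, and coefficient recursions. -/

section MatrixHardy

variable {l m n : ℕ}

theorem MemHardyMat.mul {f : Freq → Matrix (Fin l) (Fin m) ℂ} {g : Freq → Matrix (Fin m) (Fin n) ℂ}
    (hf : MemHardyMat ∞ f) (hg : MemHardyMat ∞ g) : MemHardyMat ∞ (fun ω => f ω * g ω) :=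
  fun i k => by
    simp only [Matrix.mul_apply]
    exact MemHardy.sum _ le_top fun j _ => (hf i j).mul (hg j k)

theorem MemHardyMat.mulVec {f : Freq → Matrix (Fin l) (Fin m) ℂ} {g : Freq → Fin m → ℂ}
    (hf : MemHardyMat ∞ f) (hg : MemHardyVec ∞ g) : MemHardyVec ∞ (fun ω => f ω *ᵥ g ω) :=
  fun i => by
    simp only [Matrix.mulVec, dotProduct]
    exact MemHardy.sum _ le_top fun j _ => (hf i j).mul (hg j)

theorem memHardyMat_const (M : Matrix (Fin l) (Fin m) ℂ) (p : ℝ≥0∞) :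
    MemHardyMat p (fun _ => M) := fun _ _ => memHardy_const _ _

theorem MemHardyMat.add {f g : Freq → Matrix (Fin l) (Fin m) ℂ}
    (hf : MemHardyMat ∞ f) (hg : MemHardyMat ∞ g) : MemHardyMat ∞ (fun ω => f ω + g ω) :=
  fun i k => (hf i k).add le_top (hg i k)

theorem MemHardyMat.congr {f g : Freq → Matrix (Fin l) (Fin m) ℂ} {p : ℝ≥0∞}
    (hf : MemHardyMat p f) (h : f =ᵐ[dFreq] g) : MemHardyMat p g :=
  fun i k => (hf i k).congr (by filter_upwards [h] with ω hω; rw [hω])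

theorem MemHardyMat.fourier_neg_smul {f : Freq → Matrix (Fin l) (Fin m) ℂ}
    (hf : MemHardyMat ∞ f) (k : ℕ) :
    MemHardyMat ∞ (fun ω => (fourier (-(k : ℤ)) ω : ℂ) • f ω) :=
  fun i j => (memHardy_fourier_neg k ∞).mul (hf i j)

/-- The vector of Fourier coefficients of a column of functions. -/
noncomputable def coeffVec (x : Freq → Fin n → ℂ) (k : ℤ) : Fin n → ℂ := fun i => fourierCoeff (fun ω => x ω i) k

theorem coeffVec_mulVec (a : Matrix (Fin m) (Fin n) ℂ) {x : Freq → Fin n → ℂ}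
    (hx : ∀ i, Integrable (fun ω => x ω i) dFreq) (k : ℤ) :
    coeffVec (fun ω => a *ᵥ x ω) k = a *ᵥ coeffVec x k := by
  funext i
  simp only [coeffVec, Matrix.mulVec, dotProduct]
  rw [fourierCoeff_fun_sum _ fun j _ => (hx j).const_mul _]
  simp only [fourierCoeff.const_mul]

theorem integrable_mulVec (a : Matrix (Fin m) (Fin n) ℂ) {x : Freq → Fin n → ℂ}
    (hx : ∀ i, Integrable (fun ω => x ω i) dFreq) (i : Fin m) :
    Integrable (fun ω => (a *ᵥ x ω) i) dFreq := by
  simp only [Matrix.mulVec, dotProduct]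
  exact integrable_finsetSum _ fun j _ => (hx j).const_mul _

/-- Fourier coefficients of a solution of `x = y + z^s a x`. -/
theorem coeffVec_eq_add_mulVec {a : Matrix (Fin n) (Fin n) ℂ} {x y : Freq → Fin n → ℂ} {s : ℤ}
    (hx : ∀ i, Integrable (fun ω => x ω i) dFreq) (hy : ∀ i, Integrable (fun ω => y ω i) dFreq)
    (h : ∀ ω, x ω = y ω + (fourier s ω : ℂ) • (a *ᵥ x ω)) (k : ℤ) :
    coeffVec x k = coeffVec y k + a *ᵥ coeffVec x (k - s) := by
  rw [← coeffVec_mulVec a hx]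
  funext i
  have h1 : (fun ω => x ω i) = fun ω => y ω i + fourier s ω * (a *ᵥ x ω) i := by
    funext ω
    exact congrFun (h ω) i
  simp only [coeffVec, Pi.add_apply]
  rw [h1, fourierCoeff_add_fun (hy i) (g := fun ω => fourier s ω * (a *ᵥ x ω) i)
      ((integrable_mulVec a hx i).fourier_smul s),
    fourierCoeff_fourier_mul]

theorem coeffVec_const (c : Fin n → ℂ) (k : ℤ) :
    coeffVec (fun _ => c) k = if k = 0 then c else 0 := by
  funext i
  simp only [coeffVec, fourierCoeff_const]
  split_ifs <;> rfl

end MatrixHardy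

/-! ### Resolvents of Schur matrices on the unit circle. -/

section Schur

open Filter Topology

attribute [local instance] Matrix.linftyOpNormedRing Matrix.linftyOpNormedAlgebra in
-- Gelfand's formula: the spectral radius is below some r < 1, so eventually ‖a^k‖ ≤ r^k. The
-- operator norm is only an auxiliary local instance; the conclusion is entrywise.
theorem tendsto_pow_apply_of_spectrum {n : ℕ} {a : Matrix (Fin n) (Fin n) ℂ}
    (ha : ∀ μ ∈ spectrum ℂ a, ‖μ‖ < 1) (i j : Fin n) :
    Tendsto (fun k : ℕ => (a ^ k) i j) atTop (𝓝 0) := by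
  have : Nonempty (Fin n) := ⟨i⟩
  have : CompleteSpace (Matrix (Fin n) (Fin n) ℂ) := FiniteDimensional.complete ℂ _
  have hr : spectralRadius ℂ a < (1 : NNReal) :=
    spectrum.spectralRadius_lt_of_forall_lt a fun z hz => by exact_mod_cast ha z hz
  obtain ⟨r, hr1, hr2⟩ := ENNReal.lt_iff_exists_nnreal_btwn.1 hr
  have hG := spectrum.pow_nnnorm_pow_one_div_tendsto_nhds_spectralRadius a
  have hev := hG.eventually_lt_const hr1
  have hr2' : (r : ℝ) < 1 := by exact_mod_cast hr2
  refine squeeze_zero_norm' (a := fun k : ℕ => (r : ℝ) ^ k) ?_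
    (tendsto_pow_atTop_nhds_zero_of_lt_one r.2 hr2')
  filter_upwards [hev, eventually_gt_atTop 0] with k hk hk0
  have h1 : (‖a ^ k‖₊ : ℝ≥0∞) ≤ (r : ℝ≥0∞) ^ k := by
    have h2 := ENNReal.rpow_le_rpow hk.le (Nat.cast_nonneg k)
    rw [← ENNReal.rpow_mul, one_div, inv_mul_cancel₀ (by positivity), ENNReal.rpow_one,
      ENNReal.rpow_natCast] at h2
    exact h2
  have h3 : ‖a ^ k‖₊ ≤ r ^ k := by exact_mod_cast h1
  have h4 : ‖(a ^ k) i j‖₊ ≤ ‖a ^ k‖₊ := by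
    rw [Matrix.linfty_opNNNorm_def]
    refine le_trans ?_ (Finset.le_sup (f := fun i => ∑ j, ‖(a ^ k) i j‖₊) (Finset.mem_univ i))
    exact Finset.single_le_sum (f := fun j => ‖(a ^ k) i j‖₊) (fun _ _ => zero_le) (Finset.mem_univ j)
  exact_mod_cast h4.trans h3

variable {n : ℕ} {a : Matrix (Fin n) (Fin n) ℂ}

theorem isUnit_one_sub_smul (ha : ∀ μ ∈ spectrum ℂ a, ‖μ‖ < 1) {z : ℂ} (hz : ‖z‖ = 1) :
    IsUnit (1 - z • a) := by
  have hz0 : z ≠ 0 := fun h => by simp [h] at hz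
  have h1 : z⁻¹ ∉ spectrum ℂ a := fun h => by
    have := ha _ h
    rw [norm_inv, hz, inv_one] at this
    exact lt_irrefl _ this
  rw [spectrum.notMem_iff] at h1
  have h2 : (1 : Matrix (Fin n) (Fin n) ℂ) - z • a =
      (Units.mk0 z hz0) • (algebraMap ℂ _ z⁻¹ - a) := by
    rw [Units.smul_def, smul_sub, Algebra.algebraMap_eq_smul_one, smul_smul, Units.val_mk0,
      mul_inv_cancel₀ hz0, one_smul]
  rw [h2]
  exact h1.smul _

theorem one_sub_mul_inv (ha : ∀ μ ∈ spectrum ℂ a, ‖μ‖ < 1) (s : ℤ) (ω : Freq) :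
    (1 - (fourier s ω : ℂ) • a) * (1 - (fourier s ω : ℂ) • a)⁻¹ = 1 :=
  Matrix.mul_nonsing_inv _
    ((Matrix.isUnit_iff_isUnit_det _).1 (isUnit_one_sub_smul ha (norm_fourier_apply s ω)))

theorem continuous_one_sub_inv_apply (ha : ∀ μ ∈ spectrum ℂ a, ‖μ‖ < 1) (s : ℤ) (i j : Fin n) :
    Continuous fun ω : Freq => (1 - (fourier s ω : ℂ) • a)⁻¹ i j := by
  have hc : Continuous fun ω : Freq => 1 - (fourier s ω : ℂ) • a :=
    continuous_const.sub ((fourier s).continuous.smul continuous_const)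
  simp only [Matrix.inv_def, Ring.inverse_eq_inv', Matrix.smul_apply, smul_eq_mul]
  refine Continuous.mul (hc.matrix_det.inv₀ fun ω => ?_) (hc.matrix_adjugate.matrix_elem i j)
  exact ((Matrix.isUnit_iff_isUnit_det _).1
    (isUnit_one_sub_smul ha (norm_fourier_apply s ω))).ne_zero

theorem one_sub_inv_mulVec_eq (ha : ∀ μ ∈ spectrum ℂ a, ‖μ‖ < 1) (s : ℤ) (ω : Freq)
    (c : Fin n → ℂ) :
    (1 - (fourier s ω : ℂ) • a)⁻¹ *ᵥ c =
      c + (fourier s ω : ℂ) • (a *ᵥ ((1 - (fourier s ω : ℂ) • a)⁻¹ *ᵥ c)) := by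
  have h := congrArg (· *ᵥ c) (one_sub_mul_inv ha s ω)
  simp only [sub_mul, one_mul, Matrix.sub_mulVec, Matrix.one_mulVec, Matrix.smul_mul,
    Matrix.smul_mulVec, ← Matrix.mulVec_mulVec] at h
  exact sub_eq_iff_eq_add.1 h

theorem integrable_one_sub_inv_mulVec (ha : ∀ μ ∈ spectrum ℂ a, ‖μ‖ < 1) (s : ℤ)
    (c : Fin n → ℂ) (i : Fin n) :
    Integrable (fun ω : Freq => ((1 - (fourier s ω : ℂ) • a)⁻¹ *ᵥ c) i) dFreq := by
  refine (memLp_of_continuous ?_ 1).integrable le_rfl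
  simp only [Matrix.mulVec, dotProduct]
  exact continuous_finsetSum _ fun j _ =>
    (continuous_one_sub_inv_apply ha s i j).mul continuous_const

theorem coeffVec_one_sub_inv_mulVec (ha : ∀ μ ∈ spectrum ℂ a, ‖μ‖ < 1) (s : ℤ) (c : Fin n → ℂ)
    (k : ℤ) :
    coeffVec (fun ω => (1 - (fourier s ω : ℂ) • a)⁻¹ *ᵥ c) k = (if k = 0 then c else 0) +
      a *ᵥ coeffVec (fun ω => (1 - (fourier s ω : ℂ) • a)⁻¹ *ᵥ c) (k - s) := by
  rw [← coeffVec_const]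
  exact coeffVec_eq_add_mulVec (y := fun _ => c) (integrable_one_sub_inv_mulVec ha s c)
    (fun _ => integrable_const _) (fun ω => one_sub_inv_mulVec_eq ha s ω c) k

/-- `(1 - z^s a)⁻¹` has no Fourier coefficients of index `k` with `k s < 0`. -/
theorem coeffVec_one_sub_inv_mulVec_eq_zero (ha : ∀ μ ∈ spectrum ℂ a, ‖μ‖ < 1) {s : ℤ}
    (c : Fin n → ℂ) {k : ℤ} (hk : k * s < 0) :
    coeffVec (fun ω => (1 - (fourier s ω : ℂ) • a)⁻¹ *ᵥ c) k = 0 := by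
  set x : Freq → Fin n → ℂ := fun ω => (1 - (fourier s ω : ℂ) • a)⁻¹ *ᵥ c with hx
  have hint := integrable_one_sub_inv_mulVec ha s c
  -- When k s < 0, the indices k - N s never reach 0, so the recursion x_k = a x_{k-s} iterates
  -- without a source term. The coefficients are bounded by the L¹ norm and a^N tends to 0.
  have hit : ∀ N : ℕ, coeffVec x k = (a ^ N) *ᵥ coeffVec x (k - N * s) := by
    intro N
    induction N with
    | zero => simp
    | succ N ih =>
      have hne : k - N * s ≠ 0 := fun h => by
        have h2 : k * s = N * (s * s) := by rw [sub_eq_zero.1 h]; ring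
        have h3 : (0 : ℤ) ≤ N * (s * s) := mul_nonneg (Nat.cast_nonneg N) (mul_self_nonneg s)
        lia
      rw [ih, coeffVec_one_sub_inv_mulVec ha s c (k - N * s), if_neg hne, zero_add,
        Matrix.mulVec_mulVec, ← pow_succ]
      congr 2
      push_cast
      ring
  funext i
  refine tendsto_nhds_unique (f := fun _ : ℕ => coeffVec x k i) tendsto_const_nhds ?_ (l := atTop)
  have hlim : Tendsto (fun N : ℕ => ∑ j, (a ^ N) i j * coeffVec x (k - N * s) j) atTop
      (𝓝 (∑ j : Fin n, 0)) := by
    refine tendsto_finsetSum _ fun j _ => ?_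
    refine (tendsto_pow_apply_of_spectrum ha i j).zero_mul_isBoundedUnder_le ?_
    refine isBoundedUnder_of ⟨∫ ω, ‖x ω j‖ ∂dFreq, fun N => ?_⟩
    refine (norm_integral_le_integral_norm _).trans (le_of_eq ?_)
    refine integral_congr_ae (ae_of_all _ fun ω => ?_)
    simp only [norm_smul, norm_fourier_apply, one_mul]
  rw [Finset.sum_const_zero] at hlim
  refine hlim.congr fun N => ?_
  rw [hit N]
  rfl

theorem memHardyMat_one_sub_inv (ha : ∀ μ ∈ spectrum ℂ a, ‖μ‖ < 1) :
    MemHardyMat ∞ (fun ω => (1 - (fourier (-1) ω : ℂ) • a)⁻¹) := by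
  intro i j
  refine ⟨memLp_of_continuous (continuous_one_sub_inv_apply ha _ i j) _, fun k hk => ?_⟩
  have h := congrFun (coeffVec_one_sub_inv_mulVec_eq_zero ha (s := -1) (Pi.single j 1) (k := k)
    (by lia)) i
  simpa [coeffVec] using h

theorem smul_one_sub_inv {z : ℂ} (hz : z ≠ 0) (h : IsUnit (1 - z⁻¹ • a)) :
    (z • (1 : Matrix (Fin n) (Fin n) ℂ) - a)⁻¹ = z⁻¹ • (1 - z⁻¹ • a)⁻¹ := by
  have : z • (1 : Matrix (Fin n) (Fin n) ℂ) - a = (Units.mk0 z hz) • (1 - z⁻¹ • a) := by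
    rw [Units.smul_def, smul_sub, smul_smul, Units.val_mk0, mul_inv_cancel₀ hz, one_smul]
  rw [this, Matrix.inv_smul' _ _ ((Matrix.isUnit_iff_isUnit_det _).1 h), Units.smul_def,
    Units.val_inv_eq_inv_val, Units.val_mk0]

theorem expj_ne_zero (ω : Freq) : expj ω ≠ 0 := Circle.coe_ne_zero _

theorem expj_inv (ω : Freq) : (expj ω)⁻¹ = fourier (-1) ω := by
  rw [fourier_neg, fourier_one, ← Circle.coe_inv_eq_conj, Circle.coe_inv]
  rfl

/-- For a Schur matrix, the resolvent on the unit circle is causal. -/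
theorem memHardyMat_resolvent (ha : ∀ μ ∈ spectrum ℂ a, ‖μ‖ < 1) :
    MemHardyMat ∞ (fun ω => (expj ω • (1 : Matrix (Fin n) (Fin n) ℂ) - a)⁻¹) := by
  have h := (memHardyMat_one_sub_inv ha).fourier_neg_smul 1
  intro i j
  refine (h i j).congr (ae_of_all _ fun ω => ?_)
  have hu : IsUnit (1 - (expj ω)⁻¹ • a) := by
    rw [expj_inv]
    exact isUnit_one_sub_smul ha (norm_fourier_apply _ _)
  simp only [smul_one_sub_inv (expj_ne_zero ω) hu, expj_inv]
  rfl

/-- The matrix `e^{jω} - a` is invertible for almost every frequency. -/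
theorem ae_isUnit_expj_smul_one_sub (a : Matrix (Fin n) (Fin n) ℂ) :
    ∀ᵐ ω ∂dFreq, IsUnit (expj ω • (1 : Matrix (Fin n) (Fin n) ℂ) - a) := by
  have hfin : (spectrum ℂ a).Finite := Matrix.finite_spectrum a
  have hinj : Function.Injective expj :=
    Subtype.coe_injective.comp (AddCircle.injective_toCircle Real.two_pi_pos.ne')
  have : Nontrivial Freq := by
    refine ⟨⟨((2 * π / 2 / (1 : ℤ) : ℝ) : Freq), 0, fun h => ?_⟩⟩
    have h1 := fourier_add_half_inv_index (T := 2 * π) one_ne_zero Real.two_pi_pos 0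
    rw [h, add_zero, fourier_eval_zero] at h1
    norm_num at h1
  have : ConnectedSpace Freq := Quotient.instConnectedSpace
  have : NullSingletonClass dFreq := Measure.IsAddHaarMeasure.nullSingletonClass _
  -- Finitely many eigenvalues, an injective parametrisation of the circle, and a measure without
  -- atoms.
  have hnull : dFreq (expj ⁻¹' spectrum ℂ a) = 0 :=
    (hfin.preimage hinj.injOn).measure_zero _
  filter_upwards [compl_mem_ae_iff.2 hnull] with ω hω
  have := spectrum.notMem_iff.1 hω
  rwa [Algebra.algebraMap_eq_smul_one] at this

end Schur

/-! ### Real matrices as complex ones, and square roots. -/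

section ComplexMatrices

variable {l m n : ℕ}

theorem toC_mul (M : Matrix (Fin l) (Fin m) ℝ) (N : Matrix (Fin m) (Fin n) ℝ) :
    toC (M * N) = toC M * toC N :=
  Matrix.map_mul (f := Complex.ofRealHom)

theorem toC_add (M N : Matrix (Fin l) (Fin m) ℝ) : toC (M + N) = toC M + toC N :=
  Matrix.map_add _ Complex.ofReal_add _ _

theorem toC_sub (M N : Matrix (Fin l) (Fin m) ℝ) : toC (M - N) = toC M - toC N :=
  Matrix.map_sub _ Complex.ofReal_sub _ _

theorem toC_neg (M : Matrix (Fin l) (Fin m) ℝ) : toC (-M) = -toC M := by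
  ext i j
  simp

theorem toC_one : toC (1 : Matrix (Fin n) (Fin n) ℝ) = 1 :=
  Matrix.map_one _ Complex.ofReal_zero Complex.ofReal_one

theorem toC_transpose (M : Matrix (Fin l) (Fin m) ℝ) : toC Mᵀ = (toC M)ᴴ := by
  ext i j
  simp

theorem toC_inv {M : Matrix (Fin n) (Fin n) ℝ} (hM : IsUnit M) : toC M⁻¹ = (toC M)⁻¹ := by
  refine (Matrix.inv_eq_right_inv ?_).symm
  rw [← toC_mul, Matrix.mul_nonsing_inv _ ((Matrix.isUnit_iff_isUnit_det _).1 hM), toC_one]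

theorem isUnit_toC {M : Matrix (Fin n) (Fin n) ℝ} (hM : IsUnit M) : IsUnit (toC M) :=
  hM.map (Complex.ofRealHom.mapMatrix)

theorem sqrtMat_mul_self {M : Matrix (Fin n) (Fin n) ℝ} (hM : M.PosSemidef) :
    sqrtMat M * sqrtMat M = M :=
  open scoped MatrixOrder in CFC.sqrt_mul_sqrt_self M hM.nonneg

theorem posSemidef_sqrtMat (M : Matrix (Fin n) (Fin n) ℝ) : (sqrtMat M).PosSemidef :=
  open scoped MatrixOrder in Matrix.nonneg_iff_posSemidef.1 (CFC.sqrt_nonneg M)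

theorem transpose_sqrtMat (M : Matrix (Fin n) (Fin n) ℝ) : (sqrtMat M)ᵀ = sqrtMat M := by
  rw [← Matrix.conjTranspose_eq_transpose_of_trivial]
  exact (posSemidef_sqrtMat M).isHermitian

open scoped ComplexOrder

theorem posSemidef_toC {M : Matrix (Fin n) (Fin n) ℝ} (hM : M.PosSemidef) :
    (toC M).PosSemidef := by
  rw [← sqrtMat_mul_self hM, toC_mul]
  nth_rewrite 1 [← transpose_sqrtMat]
  rw [toC_transpose]
  exact Matrix.posSemidef_conjTranspose_mul_self _

theorem posDef_toC {M : Matrix (Fin n) (Fin n) ℝ} (hM : M.PosDef) : (toC M).PosDef :=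
  (posSemidef_toC hM.posSemidef).posDef_iff_isUnit.2 (isUnit_toC hM.isUnit)

theorem eq_of_posSemidef_of_mul_self_eq {S T : Matrix (Fin n) (Fin n) ℂ} (hS : S.PosSemidef)
    (hT : T.PosSemidef) (h : S * S = T * T) : S = T :=
  open scoped MatrixOrder in
  (CFC.mul_self_eq_mul_self_iff S T hS.nonneg hT.nonneg).1 h

theorem IsSchur.transpose {M : Matrix (Fin n) (Fin n) ℝ} (hM : IsSchur M) : IsSchur Mᵀ := by
  intro μ hμ
  refine hM μ fun h => hμ ?_
  rw [spectrum.mem_resolventSet_iff] at h ⊢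
  have h' := (Matrix.isUnit_transpose _).2 h
  rwa [Matrix.transpose_sub, Algebra.algebraMap_eq_smul_one, Matrix.transpose_smul,
    Matrix.transpose_one, ← Algebra.algebraMap_eq_smul_one] at h'

/-- The matrix of Fourier coefficients of a matrix of functions. -/
noncomputable def coeffMat (f : Freq → Matrix (Fin l) (Fin m) ℂ) (k : ℤ) :
    Matrix (Fin l) (Fin m) ℂ :=
  Matrix.of fun i j => fourierCoeff (fun ω => f ω i j) k

theorem coeffMat_const_mul (a : Matrix (Fin l) (Fin m) ℂ) {f : Freq → Matrix (Fin m) (Fin n) ℂ}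
    (hf : ∀ i j, Integrable (fun ω => f ω i j) dFreq) (k : ℤ) :
    coeffMat (fun ω => a * f ω) k = a * coeffMat f k := by
  ext i j
  exact congrFun (coeffVec_mulVec a (x := fun ω i => f ω i j) (fun i => hf i j) k) i

theorem coeffMat_congr {f g : Freq → Matrix (Fin l) (Fin m) ℂ} (h : f =ᵐ[dFreq] g) (k : ℤ) :
    coeffMat f k = coeffMat g k := by
  ext i j
  refine congrFun (fourierCoeff_congr_ae ?_) k
  filter_upwards [h] with ω hω
  rw [hω]

end ComplexMatrices

/-! ### Riccati identities at a single frequency. -/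

section RiccatiAlgebra

variable {n m k : ℕ} {A AK P Q : Matrix (Fin n) (Fin n) ℂ} {B F : Matrix (Fin n) (Fin m) ℂ}
  {K : Matrix (Fin m) (Fin n) ℂ} {M R : Matrix (Fin m) (Fin m) ℂ} {Bw G : Matrix (Fin n) (Fin k) ℂ}
  {z : ℂ}

/-- The return difference identity. -/
theorem return_difference (hz : star z * z = 1) (hF : z • F = A * F + B) (hP : Pᴴ = P)
    (hM : M = R + Bᴴ * P * B) (hMs : Mᴴ = M) (hMK : M * K = Bᴴ * P * A)
    (hPQ : P = Q + Aᴴ * P * (A - B * K)) :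
    (1 + K * F)ᴴ * M * (1 + K * F) = R + Fᴴ * Q * F := by
  -- This is where |z| = 1 enters: F^*PF = (zF)^*P(zF).
  have h1 : Fᴴ * P * F = (A * F + B)ᴴ * P * (A * F + B) := by
    rw [← hF, Matrix.conjTranspose_smul, Matrix.smul_mul, Matrix.smul_mul, Matrix.mul_smul,
      smul_smul, hz, one_smul]
  have hKM : Kᴴ * M = Aᴴ * P * B := by
    have := congrArg Matrix.conjTranspose hMK
    simpa only [Matrix.conjTranspose_mul, hMs, hP, Matrix.conjTranspose_conjTranspose,
      ← Matrix.mul_assoc] using this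
  have h2 : Q = P - Aᴴ * P * (A - B * K) := eq_sub_of_add_eq hPQ.symm
  have h3 : (1 + K * F)ᴴ * M * (1 + K * F) =
      M + Fᴴ * (Kᴴ * M) + (M * K) * F + Fᴴ * ((Kᴴ * M) * (K * F)) := by
    simp only [Matrix.conjTranspose_add, Matrix.conjTranspose_mul, Matrix.conjTranspose_one,
      add_mul, mul_add, Matrix.mul_assoc, one_mul, mul_one]
    abel
  have h4 : Fᴴ * Q * F = Fᴴ * P * F - Fᴴ * (Aᴴ * P * (A - B * K)) * F := by
    rw [h2, Matrix.mul_sub, Matrix.sub_mul]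
  rw [h3, h4, h1, hKM, hMK]
  nth_rewrite 1 [hM]
  simp only [Matrix.conjTranspose_add, Matrix.conjTranspose_mul, Matrix.mul_assoc, Matrix.add_mul,
    Matrix.mul_add, Matrix.mul_sub, Matrix.sub_mul]
  abel

/-- State feedback moves the poles: F = (z - A + BK)⁻¹B(1 + KF) when the closed loop resolvent
exists. Consequently 1 - K(z - A + BK)⁻¹B inverts 1 + KF, and the inverse is causal if A - BK is
Schur. -/
theorem closedLoop_mul_eq (hF : z • F = A * F + B) :
    (z • (1 : Matrix (Fin n) (Fin n) ℂ) - (A - B * K)) * F = B * (1 + K * F) := by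
  rw [Matrix.sub_mul, Matrix.smul_mul, Matrix.one_mul, hF, Matrix.sub_mul, Matrix.mul_add,
    Matrix.mul_one, Matrix.mul_assoc]
  abel

/-- With w = z⁻¹, applying (w - a)⁻¹ separates (w - a)⁻¹QG into P(zG), which is causal because zG =
AG + B_w, and an anticausal resolvent applied to the constant aPB_w. -/
theorem resolvent_weight_eq {a : Matrix (Fin n) (Fin n) ℂ} {w : ℂ} (hz : w * z = 1)
    (hG : z • G = A * G + Bw) (hQ : Q = P - a * P * A) :
    (w • (1 : Matrix (Fin n) (Fin n) ℂ) - a) * (P * (z • G)) + a * P * Bw = Q * G := by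
  have h1 : w • (1 : Matrix (Fin n) (Fin n) ℂ) * (P * (z • G)) = P * G := by
    rw [Matrix.smul_mul, Matrix.one_mul, Matrix.mul_smul, smul_smul, hz, one_smul]
  rw [Matrix.sub_mul, h1, hG, hQ]
  simp only [Matrix.sub_mul, Matrix.mul_add, Matrix.mul_assoc]
  abel

end RiccatiAlgebra

/-! ### State-space form of the canonical factor and of ΔK_∘. -/

namespace LQSystem

open scoped ComplexOrder

variable {dx du : ℕ} (S : LQSystem dx du)

/-- At an eigenvalue of `A` on the circle the matrix inverse takes its default value 0 and the
equation can fail, hence the almost everywhere form. -/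
theorem ae_expj_smul_resolvent {k : ℕ} (B : Matrix (Fin dx) (Fin k) ℝ) :
    ∀ᵐ ω ∂dFreq, expj ω • ((expj ω • (1 : Matrix (Fin dx) (Fin dx) ℂ) - toC S.A)⁻¹ * toC B) =
      toC S.A * ((expj ω • (1 : Matrix (Fin dx) (Fin dx) ℂ) - toC S.A)⁻¹ * toC B) + toC B := by
  filter_upwards [ae_isUnit_expj_smul_one_sub (toC S.A)] with ω hω
  have h := Matrix.mul_nonsing_inv _ ((Matrix.isUnit_iff_isUnit_det _).1 hω)
  have h2 := congrArg (· * toC B) h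
  simp only [Matrix.sub_mul, Matrix.smul_mul, Matrix.one_mul, Matrix.mul_assoc] at h2
  exact sub_eq_iff_eq_add'.1 h2

theorem ae_expj_smul_F : ∀ᵐ ω ∂dFreq, expj ω • S.F ω = toC S.A * S.F ω + toC S.Bu :=
  S.ae_expj_smul_resolvent S.Bu

theorem ae_expj_smul_G : ∀ᵐ ω ∂dFreq, expj ω • S.G ω = toC S.A * S.G ω + toC S.Bw :=
  S.ae_expj_smul_resolvent S.Bw

theorem posDef_controlGram (ω : Freq) : (S.controlGram ω).PosDef :=
  (posDef_toC S.R_posDef).add_posSemidef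
    ((posSemidef_toC S.Q_posDef.posSemidef).conjTranspose_mul_mul_same _)

variable {S} {P : Matrix (Fin dx) (Fin dx) ℝ}

theorem isUnit_of_gram {Δ : Freq → Matrix (Fin du) (Fin du) ℂ} {ω : Freq}
    (hΔ : (Δ ω)ᴴ * Δ ω = S.controlGram ω) : IsUnit (Δ ω) := by
  have := (S.posDef_controlGram ω).isUnit
  rw [← hΔ, Matrix.isUnit_iff_isUnit_det, Matrix.det_mul] at this
  exact (Matrix.isUnit_iff_isUnit_det _).2 (isUnit_of_mul_isUnit_right this)

theorem posDef_innovation (hP : P.PosDef) : (S.R + S.Buᵀ * P * S.Bu).PosDef :=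
  S.R_posDef.add_posSemidef (hP.posSemidef.conjTranspose_mul_mul_same S.Bu)

theorem innovation_mul_Klqr (hP : P.PosDef) :
    (S.R + S.Buᵀ * P * S.Bu) * S.Klqr P = S.Buᵀ * P * S.A := by
  have h := Matrix.mul_nonsing_inv _
    ((Matrix.isUnit_iff_isUnit_det _).1 (posDef_innovation (S := S) hP).isUnit)
  rw [Klqr]
  simp only [← Matrix.mul_assoc] at h ⊢
  rw [h, Matrix.one_mul]

theorem IsStabilizingRiccati.eq_add (hP : S.IsStabilizingRiccati P) :
    P = S.Q + S.Aᵀ * P * (S.A - S.Bu * S.Klqr P) := by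
  refine hP.2.1.trans ?_
  rw [Klqr]
  simp only [Matrix.mul_sub, Matrix.mul_assoc]
  abel

theorem transpose_eq_of_posDef {n : ℕ} {M : Matrix (Fin n) (Fin n) ℝ} (hM : M.PosDef) : Mᵀ = M := by
  rw [← Matrix.conjTranspose_eq_transpose_of_trivial]
  exact hM.isHermitian

theorem IsStabilizingRiccati.eq_sub (hP : S.IsStabilizingRiccati P) :
    S.Q = P - S.Abar P * P * S.A := by
  have h := congrArg Matrix.transpose hP.eq_add
  rw [Matrix.transpose_add, Matrix.transpose_mul, Matrix.transpose_mul, Matrix.transpose_transpose,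
    transpose_eq_of_posDef hP.1, transpose_eq_of_posDef S.Q_posDef, ← Matrix.mul_assoc] at h
  exact eq_sub_of_add_eq h.symm

theorem isSchur_Abar (hP : S.IsStabilizingRiccati P) : IsSchur (S.Abar P) := hP.2.2.transpose

/-- The canonical spectral factor in state-space form. -/
noncomputable def stateSpaceFactor (S : LQSystem dx du) (P : Matrix (Fin dx) (Fin dx) ℝ) (ω : Freq) :
    Matrix (Fin du) (Fin du) ℂ :=
  toC (sqrtMat (S.R + S.Buᵀ * P * S.Bu)) * (1 + toC (S.Klqr P) * S.F ω)

/-- The closed loop resolvent `(e^{jω} - (A - B_u K_lqr))⁻¹`. -/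
noncomputable def closedLoopResolvent (S : LQSystem dx du) (P : Matrix (Fin dx) (Fin dx) ℝ) (ω : Freq) :
    Matrix (Fin dx) (Fin dx) ℂ :=
  (expj ω • (1 : Matrix (Fin dx) (Fin dx) ℂ) - toC (S.A - S.Bu * S.Klqr P))⁻¹

/-- The inverse of `stateSpaceFactor`. -/
noncomputable def stateSpaceFactorInv (S : LQSystem dx du) (P : Matrix (Fin dx) (Fin dx) ℝ) (ω : Freq) :
    Matrix (Fin du) (Fin du) ℂ :=
  (1 + toC (-S.Klqr P) * (S.closedLoopResolvent P ω * toC S.Bu)) *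
    (toC (sqrtMat (S.R + S.Buᵀ * P * S.Bu)))⁻¹

theorem isUnit_expj_smul_sub_closedLoop (hP : S.IsStabilizingRiccati P) (ω : Freq) :
    IsUnit (expj ω • (1 : Matrix (Fin dx) (Fin dx) ℂ) - toC (S.A - S.Bu * S.Klqr P)) := by
  by_contra h
  rw [← Algebra.algebraMap_eq_smul_one] at h
  have := hP.2.2 (expj ω) h
  rw [expj_eq_fourier, norm_fourier_apply] at this
  exact lt_irrefl _ this

theorem isUnit_sqrt_innovation (hP : P.PosDef) :
    IsUnit (sqrtMat (S.R + S.Buᵀ * P * S.Bu)) := by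
  have h := (Matrix.isUnit_iff_isUnit_det _).1 (posDef_innovation (S := S) hP).isUnit
  rw [← sqrtMat_mul_self (posDef_innovation (S := S) hP).posSemidef, Matrix.det_mul] at h
  exact (Matrix.isUnit_iff_isUnit_det _).2 (isUnit_of_mul_isUnit_left h)

theorem ae_F_eq_closedLoop (hP : S.IsStabilizingRiccati P) : ∀ᵐ ω ∂dFreq,
    S.F ω = S.closedLoopResolvent P ω * toC S.Bu * (1 + toC (S.Klqr P) * S.F ω) := by
  filter_upwards [S.ae_expj_smul_F] with ω hω
  have h := closedLoop_mul_eq (K := toC (S.Klqr P)) hω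
  rw [← toC_mul, ← toC_sub] at h
  rw [Matrix.mul_assoc, ← h, closedLoopResolvent, ← Matrix.mul_assoc,
    Matrix.nonsing_inv_mul _ ((Matrix.isUnit_iff_isUnit_det _).1
      (isUnit_expj_smul_sub_closedLoop hP ω)), Matrix.one_mul]

theorem conjTranspose_toC_sqrt (M : Matrix (Fin du) (Fin du) ℝ) :
    (toC (sqrtMat M))ᴴ = toC (sqrtMat M) := by
  rw [← toC_transpose, transpose_sqrtMat]

theorem star_expj_mul_expj (ω : Freq) : star (expj ω) * expj ω = 1 := by
  rw [expj_eq_fourier, star_fourier, ← fourier_add]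
  simp

theorem ae_stateSpaceFactor_gram (hP : S.IsStabilizingRiccati P) : ∀ᵐ ω ∂dFreq,
    (S.stateSpaceFactor P ω)ᴴ * S.stateSpaceFactor P ω = S.controlGram ω := by
  filter_upwards [S.ae_expj_smul_F] with ω hω
  have hPs : (toC P)ᴴ = toC P := by rw [← toC_transpose, transpose_eq_of_posDef hP.1]
  have hMs : (toC (S.R + S.Buᵀ * P * S.Bu))ᴴ = toC (S.R + S.Buᵀ * P * S.Bu) := by
    rw [← toC_transpose, transpose_eq_of_posDef (posDef_innovation hP.1)]
  rw [controlGram, ← return_difference (star_expj_mul_expj ω) hω hPs (K := toC (S.Klqr P))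
    (M := toC (S.R + S.Buᵀ * P * S.Bu)) ?_ hMs ?_ ?_]
  · rw [stateSpaceFactor, Matrix.conjTranspose_mul, conjTranspose_toC_sqrt, Matrix.mul_assoc,
      ← Matrix.mul_assoc (toC (sqrtMat _)), ← toC_mul,
      sqrtMat_mul_self (posDef_innovation hP.1).posSemidef, ← Matrix.mul_assoc]
  · rw [toC_add, toC_mul, toC_mul, toC_transpose]
  · rw [← toC_mul, innovation_mul_Klqr hP.1, toC_mul, toC_mul, toC_transpose]
  · have h := congrArg toC hP.eq_add
    rwa [toC_add, toC_mul, toC_mul, toC_sub, toC_mul, toC_transpose] at h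

theorem ae_stateSpaceFactorInv_mul (hP : S.IsStabilizingRiccati P) : ∀ᵐ ω ∂dFreq,
    S.stateSpaceFactorInv P ω * S.stateSpaceFactor P ω = 1 := by
  filter_upwards [ae_F_eq_closedLoop hP] with ω hω
  have h := Matrix.nonsing_inv_mul _ ((Matrix.isUnit_iff_isUnit_det _).1
    (isUnit_toC (isUnit_sqrt_innovation (S := S) hP.1)))
  rw [stateSpaceFactorInv, stateSpaceFactor, Matrix.mul_assoc, ← Matrix.mul_assoc (_⁻¹), h,
    Matrix.one_mul, Matrix.add_mul, Matrix.one_mul, Matrix.mul_assoc (toC (-_)), ← hω, toC_neg,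
    Matrix.neg_mul]
  abel

theorem memHardyMat_stateSpaceFactor (hF : MemHardyMat ∞ S.F) :
    MemHardyMat ∞ (S.stateSpaceFactor P) :=
  (memHardyMat_const _ _).mul ((memHardyMat_const _ _).add ((memHardyMat_const _ _).mul hF))

theorem memHardyMat_stateSpaceFactorInv (hP : S.IsStabilizingRiccati P) :
    MemHardyMat ∞ (S.stateSpaceFactorInv P) :=
  ((memHardyMat_const _ _).add ((memHardyMat_const _ _).mul
    ((memHardyMat_resolvent hP.2.2).mul (memHardyMat_const _ _)))).mul (memHardyMat_const _ _)

/-- F = z⁻¹(AF + B_u) has a delay. This makes M^{1/2} the value of the state-space factor at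
infinity, to be compared with the normalisation of Δ. -/
theorem fourierCoeff_F_zero (hF : MemHardyMat ∞ S.F) : coeffMat S.F 0 = 0 := by
  ext i j
  have hH := ((memHardyMat_const (toC S.A) ∞).mul hF).add (memHardyMat_const (toC S.Bu) ∞) i j
  have h1 : (fun ω => S.F ω i j) =ᵐ[dFreq]
      fun ω => fourier (-1) ω * (toC S.A * S.F ω + toC S.Bu) i j := by
    filter_upwards [S.ae_expj_smul_F] with ω hω
    rw [← hω, Matrix.smul_apply, smul_eq_mul, ← mul_assoc, ← expj_inv,
      inv_mul_cancel₀ (expj_ne_zero ω), one_mul]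
  simp only [coeffMat, Matrix.of_apply, Matrix.zero_apply]
  rw [fourierCoeff_congr_ae h1, fourierCoeff_fourier_mul]
  exact hH.2 _ (by norm_num)

theorem coeffMat_stateSpaceFactor (hF : MemHardyMat ∞ S.F) :
    coeffMat (S.stateSpaceFactor P) 0 = toC (sqrtMat (S.R + S.Buᵀ * P * S.Bu)) := by
  have hKF := (memHardyMat_const (toC (S.Klqr P)) ∞).mul hF
  unfold stateSpaceFactor
  rw [coeffMat_const_mul _ fun i j =>
    (((memHardyMat_const 1 ∞).add hKF) i j).integrable le_top]
  have : coeffMat (fun ω => 1 + toC (S.Klqr P) * S.F ω) 0 = 1 := by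
    have h1 : coeffMat (fun ω => toC (S.Klqr P) * S.F ω) 0 = 0 := by
      rw [coeffMat_const_mul _ fun i j => (hF i j).integrable le_top, fourierCoeff_F_zero hF,
        Matrix.mul_zero]
    ext i j
    have h2 := congrFun (congrFun h1 i) j
    simp only [coeffMat, Matrix.of_apply, Matrix.zero_apply, Matrix.add_apply] at h2 ⊢
    rw [fourierCoeff_add_fun (integrable_const _) ((hKF i j).integrable le_top), h2,
      fourierCoeff_const, if_pos rfl, add_zero]
  rw [this, Matrix.mul_one]

/-- The canonical spectral factor is `M^{1/2} (I + K_lqr F)`. -/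
theorem IsCanonicalFactor.ae_eq_stateSpaceFactor {Δ : Freq → Matrix (Fin du) (Fin du) ℂ}
    (hΔ : S.IsCanonicalFactor Δ) (hP : S.IsStabilizingRiccati P) (hF : MemHardyMat ∞ S.F) :
    Δ =ᵐ[dFreq] S.stateSpaceFactor P := by
  obtain ⟨hΔ1, hΔ2, hΔ3, hΔ4⟩ := hΔ
  -- The quotient U of two spectral factors is unitary almost everywhere. Both U and U^* (the
  -- state-space factor times Δ⁻¹) are causal, so U is constant.
  set U : Freq → Matrix (Fin du) (Fin du) ℂ := fun ω => Δ ω * S.stateSpaceFactorInv P ω with hU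
  have hUH : MemHardyMat ∞ U := hΔ1.mul (memHardyMat_stateSpaceFactorInv hP)
  have hV : MemHardyMat ∞ (fun ω => S.stateSpaceFactor P ω * (Δ ω)⁻¹) :=
    (memHardyMat_stateSpaceFactor hF).mul hΔ2
  have hfacts : ∀ᵐ ω ∂dFreq, (U ω)ᴴ * U ω = 1 ∧ Δ ω = U ω * S.stateSpaceFactor P ω ∧
      (U ω)ᴴ = S.stateSpaceFactor P ω * (Δ ω)⁻¹ := by
    filter_upwards [ae_stateSpaceFactor_gram hP, ae_stateSpaceFactorInv_mul hP, hΔ3]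
      with ω h1 h2 h3
    have h4 : S.stateSpaceFactor P ω * S.stateSpaceFactorInv P ω = 1 :=
      mul_eq_one_comm.1 h2
    have h5 : (U ω)ᴴ * U ω = 1 := by
      calc (U ω)ᴴ * U ω
          = (S.stateSpaceFactorInv P ω)ᴴ * ((Δ ω)ᴴ * Δ ω) * S.stateSpaceFactorInv P ω := by
            simp only [hU, Matrix.conjTranspose_mul, Matrix.mul_assoc]
        _ = (S.stateSpaceFactor P ω * S.stateSpaceFactorInv P ω)ᴴ *
              (S.stateSpaceFactor P ω * S.stateSpaceFactorInv P ω) := by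
            rw [h3, ← h1]
            simp only [Matrix.conjTranspose_mul, Matrix.mul_assoc]
        _ = 1 := by rw [h4, Matrix.conjTranspose_one, Matrix.one_mul]
    have h6 : Δ ω = U ω * S.stateSpaceFactor P ω := by
      simp only [hU]
      rw [Matrix.mul_assoc, h2, Matrix.mul_one]
    have h7 : IsUnit (Δ ω) := isUnit_of_gram h3
    refine ⟨h5, h6, ?_⟩
    have h8 : S.stateSpaceFactor P ω = (U ω)ᴴ * Δ ω := by
      rw [h6, ← Matrix.mul_assoc, h5, Matrix.one_mul]
    rw [h8, Matrix.mul_assoc, Matrix.mul_nonsing_inv _ ((Matrix.isUnit_iff_isUnit_det _).1 h7),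
      Matrix.mul_one]
  set U₀ := coeffMat U 0 with hU₀
  have hconst : U =ᵐ[dFreq] fun _ => U₀ := by
    have : ∀ i j, (fun ω => U ω i j) =ᵐ[dFreq] fun _ => U₀ i j := by
      intro i j
      refine ae_eq_const_of_memHardy_star le_top (hUH i j) fun n hn => ?_
      rw [← (hV j i).2 n hn]
      refine congrFun (fourierCoeff_congr_ae ?_) n
      filter_upwards [hfacts] with ω hω
      rw [← hω.2.2, Matrix.conjTranspose_apply]
    have h2 : ∀ᵐ ω ∂dFreq, ∀ i j, U ω i j = U₀ i j :=
      ae_all_iff.2 fun i => ae_all_iff.2 fun j => this i j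
    filter_upwards [h2] with ω hω
    ext i j
    exact hω i j
  have hunit : U₀ᴴ * U₀ = 1 := by
    obtain ⟨ω, h1, h2⟩ := (hfacts.and hconst).exists
    have h3 := h1.1
    rwa [h2] at h3
  have hΔeq : Δ =ᵐ[dFreq] fun ω => U₀ * S.stateSpaceFactor P ω := by
    filter_upwards [hfacts, hconst] with ω h1 h2
    rw [h1.2.1, h2]
  have hc : (U₀ * toC (sqrtMat (S.R + S.Buᵀ * P * S.Bu))).PosDef := by
    have h1 := coeffMat_congr hΔeq 0
    rw [coeffMat_const_mul _ fun i j => (memHardyMat_stateSpaceFactor hF i j).integrable le_top,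
      coeffMat_stateSpaceFactor hF] at h1
    rw [← h1]
    exact hΔ4
  -- Both sides are positive semidefinite with the same square since U₀ is unitary; square roots are
  -- unique.
  have hT : U₀ * toC (sqrtMat (S.R + S.Buᵀ * P * S.Bu)) =
      toC (sqrtMat (S.R + S.Buᵀ * P * S.Bu)) := by
    refine eq_of_posSemidef_of_mul_self_eq hc.posSemidef (posSemidef_toC (posSemidef_sqrtMat _)) ?_
    nth_rewrite 1 [← hc.isHermitian.eq]
    rw [Matrix.conjTranspose_mul, conjTranspose_toC_sqrt, Matrix.mul_assoc, ← Matrix.mul_assoc U₀ᴴ,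
      hunit, Matrix.one_mul]
  filter_upwards [hΔeq] with ω hω
  rw [hω, stateSpaceFactor, ← Matrix.mul_assoc, hT]

/-- The state-space form of `Δ K_∘`. -/
theorem IsCanonicalFactor.ae_mulVec_Knc_eq {Δ : Freq → Matrix (Fin du) (Fin du) ℂ}
    (hΔ : S.IsCanonicalFactor Δ) (hP : S.IsStabilizingRiccati P) (hF : MemHardyMat ∞ S.F) :
    ∀ᵐ ω ∂dFreq, Δ ω *ᵥ S.Knc ω =
      (toC (S.Cbar P) * toC P * (toC S.A * S.G ω + toC S.Bw)).col 0 +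
      toC (S.Cbar P) *ᵥ (((expj ω)⁻¹ • (1 : Matrix (Fin dx) (Fin dx) ℂ) - toC (S.Abar P))⁻¹ *ᵥ
        (toC (S.Dbar P)).col 0) := by
  filter_upwards [hΔ.ae_eq_stateSpaceFactor hP hF, ae_stateSpaceFactor_gram hP,
    ae_F_eq_closedLoop hP, S.ae_expj_smul_G] with ω h1 h2 h3 h4
  set H := toC (sqrtMat (S.R + S.Buᵀ * P * S.Bu)) with hH
  have hHs : Hᴴ = H := conjTranspose_toC_sqrt _
  have hHu : IsUnit H := isUnit_toC (isUnit_sqrt_innovation (S := S) hP.1)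
  have hw : (expj ω)⁻¹ * expj ω = 1 := inv_mul_cancel₀ (expj_ne_zero ω)
  have hstar : star (expj ω) = (expj ω)⁻¹ := by
    rw [expj_inv, expj_eq_fourier, star_fourier]
  set W := ((expj ω)⁻¹ • (1 : Matrix (Fin dx) (Fin dx) ℂ) - toC (S.Abar P))⁻¹ with hW
  have hadj : (S.closedLoopResolvent P ω)ᴴ = W := by
    rw [closedLoopResolvent, Matrix.conjTranspose_nonsing_inv, hW, Matrix.conjTranspose_sub,
      Matrix.conjTranspose_smul, Matrix.conjTranspose_one, hstar, ← toC_transpose]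
    rfl
  have hWu : W * ((expj ω)⁻¹ • (1 : Matrix (Fin dx) (Fin dx) ℂ) - toC (S.Abar P)) = 1 := by
    rw [hW]
    refine Matrix.nonsing_inv_mul _ ((Matrix.isUnit_iff_isUnit_det _).1 ?_)
    have := (Matrix.isUnit_conjTranspose _).2 (isUnit_expj_smul_sub_closedLoop hP ω)
    rwa [Matrix.conjTranspose_sub, Matrix.conjTranspose_smul, Matrix.conjTranspose_one, hstar,
      ← toC_transpose] at this
  have hQ : toC S.Q = toC P - toC (S.Abar P) * toC P * toC S.A := by
    rw [hP.eq_sub, toC_sub, toC_mul, toC_mul]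
  have hC : toC (S.Cbar P) = -(H⁻¹ * (toC S.Bu)ᴴ) := by
    rw [Cbar, toC_neg, toC_mul, toC_transpose, toC_transpose, toC_inv (isUnit_sqrt_innovation hP.1),
      Matrix.conjTranspose_nonsing_inv, hHs]
  have hD : toC (S.Dbar P) = toC (S.Abar P) * toC P * toC S.Bw := by
    rw [Dbar, toC_mul, toC_mul]
    rfl
  have hΔu : IsUnit (Δ ω)ᴴ :=
    (Matrix.isUnit_conjTranspose _).2 (isUnit_of_gram (by rw [h1, h2]))
  have hres : W * (toC S.Q * S.G ω) =
      toC P * (toC S.A * S.G ω + toC S.Bw) + W * toC (S.Dbar P) := by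
    rw [← resolvent_weight_eq hw h4 hQ, Matrix.mul_add, ← Matrix.mul_assoc W, hWu, Matrix.one_mul,
      h4, hD]
  have hΔs : (Δ ω)ᴴ = (1 + toC (S.Klqr P) * S.F ω)ᴴ * H := by
    rw [h1, stateSpaceFactor, Matrix.conjTranspose_mul, hHs]
  have hFs : (S.F ω)ᴴ = (1 + toC (S.Klqr P) * S.F ω)ᴴ * ((toC S.Bu)ᴴ * W) := by
    rw [← hadj, ← Matrix.conjTranspose_mul, ← Matrix.conjTranspose_mul, ← h3]
  have hdet := (Matrix.isUnit_iff_isUnit_det _).1 hΔu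
  -- Multiply by Δ^*, which is invertible: the left side becomes -F^*QG, and F^* and Δ^* share the
  -- left factor (1 + K_lqr F)^*.
  have key : Δ ω * (-((S.controlGram ω)⁻¹ * (S.F ω)ᴴ * toC S.Q * S.G ω)) =
      toC (S.Cbar P) * (W * (toC S.Q * S.G ω)) := by
    rw [← Matrix.nonsing_inv_mul_cancel_left _ (Δ ω * _) hdet,
      ← Matrix.nonsing_inv_mul_cancel_left _ (toC (S.Cbar P) * _) hdet]
    congr 1
    calc (Δ ω)ᴴ * (Δ ω * (-((S.controlGram ω)⁻¹ * (S.F ω)ᴴ * toC S.Q * S.G ω)))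
        = -((S.controlGram ω * (S.controlGram ω)⁻¹) * ((S.F ω)ᴴ * (toC S.Q * S.G ω))) := by
          rw [← Matrix.mul_assoc, h1, h2, Matrix.mul_neg]
          simp only [Matrix.mul_assoc]
      _ = -((1 + toC (S.Klqr P) * S.F ω)ᴴ *
            ((H * H⁻¹) * ((toC S.Bu)ᴴ * (W * (toC S.Q * S.G ω))))) := by
          rw [Matrix.mul_nonsing_inv _ ((Matrix.isUnit_iff_isUnit_det _).1
              (S.posDef_controlGram ω).isUnit), Matrix.mul_nonsing_inv _
              ((Matrix.isUnit_iff_isUnit_det _).1 hHu), Matrix.one_mul, Matrix.one_mul]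
          nth_rewrite 1 [hFs]
          simp only [Matrix.mul_assoc]
      _ = (Δ ω)ᴴ * (toC (S.Cbar P) * (W * (toC S.Q * S.G ω))) := by
          rw [hΔs, hC]
          simp only [Matrix.mul_assoc, Matrix.neg_mul, Matrix.mul_neg]
  change (Δ ω * (-((S.controlGram ω)⁻¹ * (S.F ω)ᴴ * toC S.Q * S.G ω))).col 0 = _
  rw [key, hres, Matrix.mul_add, ← Matrix.mul_assoc]
  rfl

end LQSystem

/-! ### The anticausal part of an anticausal resolvent times a causal function. -/

section AnticausalResolvent

variable {n m : ℕ} {a : Matrix (Fin n) (Fin n) ℂ}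

theorem inv_expj_smul_resolvent (ha : ∀ μ ∈ spectrum ℂ a, ‖μ‖ < 1) (ω : Freq) :
    ((expj ω)⁻¹ • (1 : Matrix (Fin n) (Fin n) ℂ) - a)⁻¹ =
      (fourier 1 ω : ℂ) • (1 - (fourier 1 ω : ℂ) • a)⁻¹ := by
  have h := smul_one_sub_inv (a := a) (inv_ne_zero (expj_ne_zero ω)) (by
    rw [inv_inv, expj_eq_fourier]
    exact isUnit_one_sub_smul ha (norm_fourier_apply _ _))
  rw [h, inv_inv, expj_eq_fourier]

/-- The coefficients with nonnegative index of `(1 - z a)⁻¹ d L`, for a causal `L`. -/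
theorem coeffVec_smul_one_sub_inv_mulVec (ha : ∀ μ ∈ spectrum ℂ a, ‖μ‖ < 1) {L : Freq → ℂ}
    (hL : MemHardy 2 L) (d : Fin n → ℂ) (k : ℕ) :
    coeffVec (fun ω => L ω • ((1 - (fourier 1 ω : ℂ) • a)⁻¹ *ᵥ d)) k =
      coeffVec (fun ω => (1 - (fourier 1 ω : ℂ) • a)⁻¹ *ᵥ
        coeffVec (fun ω => L ω • ((1 - (fourier 1 ω : ℂ) • a)⁻¹ *ᵥ d)) 0) k := by
  set V : Freq → Fin n → ℂ := fun ω => L ω • ((1 - (fourier 1 ω : ℂ) • a)⁻¹ *ᵥ d) with hV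
  induction k with
  | zero =>
    rw [Nat.cast_zero, coeffVec_one_sub_inv_mulVec ha, if_pos rfl,
      coeffVec_one_sub_inv_mulVec_eq_zero ha _ (by norm_num), Matrix.mulVec_zero, add_zero]
  | succ k ih =>
    have hVint : ∀ i, Integrable (fun ω => V ω i) dFreq := fun i => by
      have hc : Continuous fun ω : Freq => ((1 - (fourier 1 ω : ℂ) • a)⁻¹ *ᵥ d) i := by
        simp only [Matrix.mulVec, dotProduct]
        exact continuous_finsetSum _ fun j _ =>
          (continuous_one_sub_inv_apply ha 1 i j).mul continuous_const
      exact hL.1.mul_two (memLp_of_continuous hc 2)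
    -- Both sides satisfy x_{k+1} = a x_k for k ≥ 0, since the source L d has no coefficients of
    -- positive index; they agree at k = 0.
    have hrec := coeffVec_eq_add_mulVec (a := a) (x := V) (y := fun ω => L ω • d) (s := 1) hVint
      (fun i => hL.1.integrable_two.mul_const (d i)) (fun ω => by
        simp only [hV]
        nth_rewrite 1 [one_sub_inv_mulVec_eq ha]
        rw [smul_add, Matrix.mulVec_smul, smul_comm]) ((k + 1 : ℕ) : ℤ)
    have hzero : coeffVec (fun ω => L ω • d) ((k + 1 : ℕ) : ℤ) = 0 := by
      funext i
      have := fourierCoeff.const_mul L (d i) ((k + 1 : ℕ) : ℤ)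
      rw [hL.2 _ (by lia), mul_zero] at this
      simp only [coeffVec, Pi.smul_apply, smul_eq_mul, mul_comm (L _)]
      exact this
    have hsub : ((k + 1 : ℕ) : ℤ) - 1 = k := by lia
    rw [hrec, hzero, coeffVec_one_sub_inv_mulVec ha, if_neg (by lia), hsub, ih]

/-- The term y L is causal and drops out. The other is z c(1 - za)⁻¹d L; because of the factor z its
coefficients of index k ≥ 1 involve only those of (1 - za)⁻¹d L with index k - 1 ≥ 0, which are
those of (1 - za)⁻¹ applied to the mean. -/
theorem anticausalPart_resolvent (ha : ∀ μ ∈ spectrum ℂ a, ‖μ‖ < 1) {L : Freq → ℂ}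
    (hL : MemHardy 2 L) (d : Fin n → ℂ) (c : Matrix (Fin m) (Fin n) ℂ) {y : Freq → Fin m → ℂ}
    (hy : MemHardyVec ∞ y) {f : Freq → Fin m → ℂ}
    (hf : ∀ᵐ ω ∂dFreq, f ω = L ω • (y ω +
      c *ᵥ (((expj ω)⁻¹ • (1 : Matrix (Fin n) (Fin n) ℂ) - a)⁻¹ *ᵥ d))) (i : Fin m) :
    anticausalPart (fun ω => f ω i) =ᵐ[dFreq] fun ω =>
      (c *ᵥ (((expj ω)⁻¹ • (1 : Matrix (Fin n) (Fin n) ℂ) - a)⁻¹ *ᵥ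
        coeffVec (fun ω => L ω • ((1 - (fourier 1 ω : ℂ) • a)⁻¹ *ᵥ d)) 0)) i := by
  set V : Freq → Fin n → ℂ := fun ω => L ω • ((1 - (fourier 1 ω : ℂ) • a)⁻¹ *ᵥ d) with hV
  set b := coeffVec V 0 with hb
  have hcont : ∀ (e : Fin n → ℂ) (j : Fin n),
      Continuous fun ω : Freq => ((1 - (fourier 1 ω : ℂ) • a)⁻¹ *ᵥ e) j := fun e j => by
    simp only [Matrix.mulVec, dotProduct]
    exact continuous_finsetSum _ fun k _ =>
      (continuous_one_sub_inv_apply ha 1 j k).mul continuous_const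
  have hVint : ∀ j, Integrable (fun ω => V ω j) dFreq := fun j =>
    hL.1.mul_two (memLp_of_continuous (hcont d j) 2)
  have hshift : ∀ (x : Freq → Fin n → ℂ), (∀ j, Integrable (fun ω => x ω j) dFreq) → ∀ k : ℤ,
      fourierCoeff (fun ω => (fourier 1 ω : ℂ) * (c *ᵥ x ω) i) k =
        (c *ᵥ coeffVec x (k - 1)) i := fun x hx k => by
    rw [fourierCoeff_fourier_mul, ← coeffVec_mulVec c hx]
    rfl
  have hg : (fun ω => (c *ᵥ (((expj ω)⁻¹ • (1 : Matrix (Fin n) (Fin n) ℂ) - a)⁻¹ *ᵥ b)) i) =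
      fun ω => (fourier 1 ω : ℂ) * (c *ᵥ ((1 - (fourier 1 ω : ℂ) • a)⁻¹ *ᵥ b)) i := by
    funext ω
    rw [inv_expj_smul_resolvent ha, Matrix.smul_mulVec, Matrix.mulVec_smul]
    rfl
  have hfi : (fun ω => f ω i) =ᵐ[dFreq]
      fun ω => y ω i * L ω + (fourier 1 ω : ℂ) * (c *ᵥ V ω) i := by
    filter_upwards [hf] with ω hω
    rw [hω, inv_expj_smul_resolvent ha, Matrix.smul_mulVec, Matrix.mulVec_smul, hV]
    simp only [Matrix.mulVec_smul, Pi.smul_apply, Pi.add_apply, smul_eq_mul]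
    ring
  rw [hg]
  refine anticausalPart_ae_eq ?_ (fun k hk => ?_) (fun k hk => ?_)
  · refine memLp_of_continuous ((fourier 1).continuous.mul ?_) 2
    exact continuous_finsetSum Finset.univ fun j _ => continuous_const.mul (hcont b j)
  · have hk1 : k - 1 = ((k - 1).toNat : ℤ) := by lia
    rw [hshift _ (integrable_one_sub_inv_mulVec ha 1 b), fourierCoeff_congr_ae hfi,
      fourierCoeff_add_fun (((hy i).mul_two hL).1.integrable_two)
        (g := fun ω => (fourier 1 ω : ℂ) * (c *ᵥ V ω) i)
        ((integrable_mulVec c hVint i).fourier_smul 1), ((hy i).mul_two hL).2 k hk, zero_add,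
      hshift V hVint, hk1, coeffVec_smul_one_sub_inv_mulVec ha hL]
  · rw [hshift _ (integrable_one_sub_inv_mulVec ha 1 b),
      coeffVec_one_sub_inv_mulVec_eq_zero ha _ (by lia), Matrix.mulVec_zero]
    rfl

end AnticausalResolvent

/-! ### State-space form of S_-. -/

namespace LQSystem

open scoped ComplexOrder

variable {dx du : ℕ} {S : LQSystem dx du} {P : Matrix (Fin dx) (Fin dx) ℝ}
  {Δ : Freq → Matrix (Fin du) (Fin du) ℂ}

theorem memHardyVec_stateSpace_causal_part (hG : MemHardyMat ∞ S.G)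
    (P : Matrix (Fin dx) (Fin dx) ℝ) : MemHardyVec ∞ (fun ω =>
      (toC (S.Cbar P) * toC P * (toC S.A * S.G ω + toC S.Bw)).col 0) := fun i =>
  ((memHardyMat_const _ _).mul (((memHardyMat_const _ _).mul hG).add (memHardyMat_const _ _))) i 0

/-- The state-space form of `{Δ K_∘ L}_-`. -/
theorem IsCanonicalFactor.ae_Sminus_eq (hΔ : S.IsCanonicalFactor Δ)
    (hP : S.IsStabilizingRiccati P) (hF : MemHardyMat ∞ S.F) (hG : MemHardyMat ∞ S.G)
    {L : Freq → ℂ} (hL : MemHardy 2 L) : ∀ᵐ ω ∂dFreq, S.Sminus Δ L ω =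
      toC (S.Cbar P) *ᵥ (((expj ω)⁻¹ • (1 : Matrix (Fin dx) (Fin dx) ℂ) - toC (S.Abar P))⁻¹ *ᵥ
        S.Bbar P L) := by
  have hB : S.Bbar P L = coeffVec (fun ω =>
      L ω • ((1 - (fourier 1 ω : ℂ) • toC (S.Abar P))⁻¹ *ᵥ (toC (S.Dbar P)).col 0)) 0 := by
    funext i
    refine integral_congr_ae (ae_of_all _ fun ω => ?_)
    simp only [expj_eq_fourier, neg_zero, fourier_zero, one_smul]
    rw [Pi.smul_apply, smul_eq_mul, mul_comm]
    rfl
  have h : ∀ᵐ ω ∂dFreq, ∀ i, S.Sminus Δ L ω i = (toC (S.Cbar P) *ᵥ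
      (((expj ω)⁻¹ • (1 : Matrix (Fin dx) (Fin dx) ℂ) - toC (S.Abar P))⁻¹ *ᵥ S.Bbar P L)) i := by
    rw [ae_all_iff]
    intro i
    rw [hB]
    refine anticausalPart_resolvent (isSchur_Abar hP) hL _ _
      (memHardyVec_stateSpace_causal_part hG P) ?_ i
    filter_upwards [hΔ.ae_mulVec_Knc_eq hP hF] with ω hω
    rw [hω]
  filter_upwards [h] with ω hω
  funext i
  exact hω i

/-- Boundedness is read off the state-space form: a bounded causal term plus a continuous one. It
keeps products with Λ ∈ L₁ integrable. -/
theorem IsCanonicalFactor.memLp_mulVec_Knc (hΔ : S.IsCanonicalFactor Δ)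
    (hP : S.IsStabilizingRiccati P) (hF : MemHardyMat ∞ S.F) (hG : MemHardyMat ∞ S.G)
    (i : Fin du) : MemLp (fun ω => (Δ ω *ᵥ S.Knc ω) i) ∞ dFreq := by
  have hc : MemLp (fun ω : Freq => (toC (S.Cbar P) *ᵥ ((fourier 1 ω : ℂ) •
      ((1 - (fourier 1 ω : ℂ) • toC (S.Abar P))⁻¹ *ᵥ (toC (S.Dbar P)).col 0))) i) ∞ dFreq := by
    refine memLp_of_continuous ?_ _
    simp only [Matrix.mulVec, dotProduct, Pi.smul_apply, smul_eq_mul]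
    exact continuous_finsetSum _ fun j _ => continuous_const.mul ((fourier 1).continuous.mul
      (continuous_finsetSum _ fun k _ =>
        (continuous_one_sub_inv_apply (isSchur_Abar hP) 1 j k).mul continuous_const))
  refine (((memHardyVec_stateSpace_causal_part hG P) i).1.add hc).ae_eq ?_
  filter_upwards [hΔ.ae_mulVec_Knc_eq hP hF] with ω hω
  rw [hω, inv_expj_smul_resolvent (isSchur_Abar hP), Matrix.smul_mulVec]
  rfl

end LQSystem

/-! ### Completion of squares and the closed loop norm. -/

theorem quadratic_cost_add {n m : ℕ} {Q : Matrix (Fin n) (Fin n) ℂ} {R : Matrix (Fin m) (Fin m) ℂ}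
    {F : Matrix (Fin n) (Fin m) ℂ} {u : Fin n → ℂ} {x h : Fin m → ℂ} (hQ : Qᴴ = Q) (hR : Rᴴ = R)
    (h0 : Fᴴ *ᵥ (Q *ᵥ u) + R *ᵥ x = 0) :
    star (u + F *ᵥ h) ⬝ᵥ (Q *ᵥ (u + F *ᵥ h)) + star (x + h) ⬝ᵥ (R *ᵥ (x + h)) =
      (star u ⬝ᵥ (Q *ᵥ u) + star x ⬝ᵥ (R *ᵥ x)) + star h ⬝ᵥ ((R + Fᴴ * Q * F) *ᵥ h) := by
  -- `h0` is the stationarity of the cost at x, so the cross terms cancel.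
  have h1 : star (F *ᵥ h) ⬝ᵥ (Q *ᵥ u) + star h ⬝ᵥ (R *ᵥ x) = 0 := by
    rw [Matrix.star_mulVec, ← Matrix.dotProduct_mulVec, ← dotProduct_add, h0, dotProduct_zero]
  have h2 : star u ⬝ᵥ (Q *ᵥ (F *ᵥ h)) + star x ⬝ᵥ (R *ᵥ h) = 0 := by
    have h3 := congrArg star h1
    rw [star_add, star_zero, ← Matrix.star_dotProduct, ← Matrix.star_dotProduct,
      Matrix.star_mulVec, Matrix.star_mulVec, hQ, hR, ← Matrix.dotProduct_mulVec,
      ← Matrix.dotProduct_mulVec] at h3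
    exact h3
  have h4 : star (F *ᵥ h) ⬝ᵥ (Q *ᵥ (F *ᵥ h)) + star h ⬝ᵥ (R *ᵥ h) =
      star h ⬝ᵥ ((R + Fᴴ * Q * F) *ᵥ h) := by
    rw [Matrix.star_mulVec, ← Matrix.dotProduct_mulVec, ← dotProduct_add, Matrix.add_mulVec,
      ← Matrix.mulVec_mulVec, ← Matrix.mulVec_mulVec, add_comm]
  rw [← h4]
  simp only [star_add, Matrix.mulVec_add, add_dotProduct, dotProduct_add]
  linear_combination h1 + h2

theorem re_star_dotProduct_self {n : ℕ} (x : Fin n → ℂ) : (star x ⬝ᵥ x).re = ∑ i, ‖x i‖ ^ 2 := by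
  simp only [dotProduct, Pi.star_apply, Complex.re_sum]
  refine Finset.sum_congr rfl fun i _ => ?_
  rw [RCLike.star_def, Complex.conj_mul', ← Complex.ofReal_pow, Complex.ofReal_re]

namespace LQSystem

open scoped ComplexOrder

variable {dx du : ℕ} {S : LQSystem dx du} {Δ : Freq → Matrix (Fin du) (Fin du) ℂ}

theorem conjTranspose_toC_posDef {n : ℕ} {M : Matrix (Fin n) (Fin n) ℝ} (hM : M.PosDef) :
    (toC M)ᴴ = toC M := (posDef_toC hM).isHermitian

/-- Completion of squares. -/
theorem gram_eq_gram_Knc_add {K : Freq → Fin du → ℂ} {ω : Freq}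
    (hΔ : (Δ ω)ᴴ * Δ ω = S.controlGram ω) :
    S.gram K ω = S.gram S.Knc ω + ∑ i, ‖(Δ ω *ᵥ (K ω - S.Knc ω)) i‖ ^ 2 := by
  have hg : (fun i => S.G ω i 0) = (S.G ω).col 0 := rfl
  have h0 : (S.F ω)ᴴ *ᵥ (toC S.Q *ᵥ S.stateResponse S.Knc ω) + toC S.R *ᵥ S.Knc ω = 0 := by
    have hK : S.Knc ω = -((S.controlGram ω)⁻¹ *ᵥ ((S.F ω)ᴴ *ᵥ (toC S.Q *ᵥ (S.G ω).col 0))) := by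
      have : S.Knc ω = (-((S.controlGram ω)⁻¹ * (S.F ω)ᴴ * toC S.Q * S.G ω)).col 0 := rfl
      rw [this]
      funext i
      rw [Matrix.mulVec_mulVec, Matrix.mulVec_mulVec]
      rfl
    have hc : S.controlGram ω *ᵥ S.Knc ω = -((S.F ω)ᴴ *ᵥ (toC S.Q *ᵥ (S.G ω).col 0)) := by
      rw [hK, Matrix.mulVec_neg, Matrix.mulVec_mulVec, Matrix.mul_nonsing_inv _
        ((Matrix.isUnit_iff_isUnit_det _).1 (S.posDef_controlGram ω).isUnit), Matrix.one_mulVec]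
    rw [controlGram, Matrix.add_mulVec, ← Matrix.mulVec_mulVec, ← Matrix.mulVec_mulVec] at hc
    rw [stateResponse, hg, Matrix.mulVec_add, Matrix.mulVec_add]
    linear_combination hc
  have h := quadratic_cost_add (h := K ω - S.Knc ω) (conjTranspose_toC_posDef S.Q_posDef)
    (conjTranspose_toC_posDef S.R_posDef) h0
  have h1 : S.stateResponse S.Knc ω + S.F ω *ᵥ (K ω - S.Knc ω) = S.stateResponse K ω := by
    rw [stateResponse, stateResponse, Matrix.mulVec_sub]
    abel
  rw [h1, add_sub_cancel] at h
  rw [gram, h, Complex.add_re, gram, ← re_star_dotProduct_self, Matrix.star_mulVec,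
    ← Matrix.dotProduct_mulVec, Matrix.mulVec_mulVec, hΔ, controlGram]

theorem memLp_dotProduct_mulVec {n : ℕ} (M : Matrix (Fin n) (Fin n) ℂ) {x : Freq → Fin n → ℂ}
    (hx : ∀ i, MemLp (fun ω => x ω i) ∞ dFreq) :
    MemLp (fun ω => star (x ω) ⬝ᵥ (M *ᵥ x ω)) ∞ dFreq := by
  simp only [dotProduct, Matrix.mulVec, Pi.star_apply]
  exact memLp_finsetSum _ fun i _ => (hx i).star_fun.mul_top
    (memLp_finsetSum _ fun j _ => (hx j).const_mul _)

theorem memLp_gram (hF : MemHardyMat ∞ S.F) (hG : MemHardyMat ∞ S.G) {K : Freq → Fin du → ℂ}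
    (hK : MemHardyVec ∞ K) : MemLp (S.gram K) ∞ dFreq := by
  have hs : ∀ i, MemLp (fun ω => S.stateResponse K ω i) ∞ dFreq := fun i =>
    (hF.mulVec hK i).1.add (hG i 0).1
  exact ((memLp_dotProduct_mulVec _ hs).add (memLp_dotProduct_mulVec _ fun i => (hK i).1)).re

theorem normHInf_le_iff {γ : ℝ} (hγ : 0 ≤ γ) (K : Freq → Fin du → ℂ) :
    S.normHInf K ≤ ENNReal.ofReal γ ↔ ∀ᵐ ω ∂dFreq, S.gram K ω ≤ γ ^ 2 := by
  constructor
  · intro h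
    filter_upwards [ENNReal.ae_le_essSup fun ω => ENNReal.ofReal (Real.sqrt (S.gram K ω))]
      with ω hω
    exact (Real.sqrt_le_left hγ).1 ((ENNReal.ofReal_le_ofReal_iff hγ).1 (hω.trans h))
  · intro h
    refine essSup_le_of_ae_le _ ?_
    filter_upwards [h] with ω hω
    exact ENNReal.ofReal_le_ofReal ((Real.sqrt_le_left hγ).2 hω)

theorem ae_gram_lt_of_normHInf_lt {γ : ℝ} {K : Freq → Fin du → ℂ}
    (h : S.normHInf K < ENNReal.ofReal γ) : ∀ᵐ ω ∂dFreq, S.gram K ω < γ ^ 2 := by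
  filter_upwards [ENNReal.ae_le_essSup fun ω => ENNReal.ofReal (Real.sqrt (S.gram K ω))]
    with ω hω
  have h1 := (ENNReal.ofReal_lt_ofReal_iff_of_nonneg (Real.sqrt_nonneg _)).1 (hω.trans_lt h)
  exact (Real.sqrt_lt' ((Real.sqrt_nonneg _).trans_lt h1)).1 h1

/-- K_∘ minimises the cost at almost every frequency, so it does no worse than a causal controller
whose norm is strictly below γ. -/
theorem ae_gram_Knc_lt (hΔ : S.IsCanonicalFactor Δ) {γ : ℝ} (hγ : S.gammaInf < ENNReal.ofReal γ) :
    ∀ᵐ ω ∂dFreq, S.gram S.Knc ω < γ ^ 2 := by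
  obtain ⟨K, hK⟩ := iInf_lt_iff.1 hγ
  obtain ⟨_, hK⟩ := iInf_lt_iff.1 hK
  filter_upwards [ae_gram_lt_of_normHInf_lt hK, hΔ.2.2.1] with ω h1 h2
  rw [gram_eq_gram_Knc_add h2] at h1
  exact lt_of_le_of_lt (le_add_of_nonneg_right (Finset.sum_nonneg fun _ _ => sq_nonneg _)) h1

/-! ### Lagrangian duality at a saddle point. -/

theorem lagrangian_eq (hF : MemHardyMat ∞ S.F) (hG : MemHardyMat ∞ S.G) {K : Freq → Fin du → ℂ}
    (hK : MemHardyVec ∞ K) (γ : ℝ) {Λ : Freq → ℝ} (hΛ : Integrable Λ dFreq) :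
    S.lagrangian γ K Λ = S.sqNormH2 K + ∫ ω, (S.gram K ω - γ ^ 2) * Λ ω ∂dFreq := by
  have hg := memLp_gram hF hG hK
  have h1 : Integrable (S.gram K) dFreq := hg.integrable le_top
  have h2 : Integrable (fun ω => S.gram K ω * Λ ω) dFreq :=
    (memLp_one_iff_integrable.2 hΛ).mul (r := 1) hg |> memLp_one_iff_integrable.1
  simp only [lagrangian, sqNormH2, mul_add, mul_one, sub_mul]
  rw [integral_add h1 h2, integral_sub h2 (hΛ.const_mul _), integral_const_mul]
  ring

/-- Complementary slackness at a saddle point. -/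
theorem IsSaddlePoint.ae_slack (hF : MemHardyMat ∞ S.F) (hG : MemHardyMat ∞ S.G) {γ : ℝ}
    {K : Freq → Fin du → ℂ} {Λ : Freq → ℝ} (h : S.IsSaddlePoint γ K Λ) :
    (∀ᵐ ω ∂dFreq, S.gram K ω ≤ γ ^ 2) ∧
      ∀ᵐ ω ∂dFreq, (S.gram K ω - γ ^ 2) * Λ ω = 0 := by
  obtain ⟨hK, hΛ, hΛ0, -, hmax⟩ := h
  have hD : MemLp (fun ω => S.gram K ω - γ ^ 2) ∞ dFreq :=
    (memLp_gram hF hG hK).sub (memLp_const _)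
  have hDmul : ∀ {Λ' : Freq → ℝ}, Integrable Λ' dFreq →
      Integrable (fun ω => (S.gram K ω - γ ^ 2) * Λ' ω) dFreq := fun h =>
    (memLp_one_iff_integrable.2 h).mul (r := 1) hD |> memLp_one_iff_integrable.1
  have hmax' : ∀ Λ' : Freq → ℝ, Integrable Λ' dFreq → (∀ᵐ ω ∂dFreq, 0 ≤ Λ' ω) →
      ∫ ω, (S.gram K ω - γ ^ 2) * Λ' ω ∂dFreq ≤ ∫ ω, (S.gram K ω - γ ^ 2) * Λ ω ∂dFreq := by
    intro Λ' h1 h2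
    have := hmax Λ' h1 h2
    rw [lagrangian_eq hF hG hK γ h1, lagrangian_eq hF hG hK γ hΛ] at this
    linarith
  have hle : ∀ᵐ ω ∂dFreq, S.gram K ω ≤ γ ^ 2 := by
    have hp : Integrable (fun ω => max (S.gram K ω - γ ^ 2) 0) dFreq :=
      (hD.integrable le_top).pos_part
    -- Increasing Λ by the constraint violation itself would raise the Lagrangian by the integral of
    -- its square.
    have h1 := hmax' (fun ω => Λ ω + max (S.gram K ω - γ ^ 2) 0) (hΛ.add hp) (by
      filter_upwards [hΛ0] with ω hω using add_nonneg hω (le_max_right _ _))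
    simp only [mul_add] at h1
    rw [integral_add (hDmul hΛ) (hDmul hp)] at h1
    have hnn : ∀ ω, 0 ≤ (S.gram K ω - γ ^ 2) * max (S.gram K ω - γ ^ 2) 0 := fun ω => by
      rcases le_total (S.gram K ω - γ ^ 2) 0 with h | h
      · rw [max_eq_right h, mul_zero]
      · rw [max_eq_left h]
        exact mul_self_nonneg _
    have h2 : ∫ ω, (S.gram K ω - γ ^ 2) * max (S.gram K ω - γ ^ 2) 0 ∂dFreq = 0 :=
      le_antisymm (by linarith) (integral_nonneg hnn)
    rw [integral_eq_zero_iff_of_nonneg hnn (hDmul hp)] at h2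
    filter_upwards [h2] with ω hω
    by_contra hlt
    have hpos : 0 < S.gram K ω - γ ^ 2 := sub_pos.2 (not_le.1 hlt)
    have : (S.gram K ω - γ ^ 2) * max (S.gram K ω - γ ^ 2) 0 = 0 := hω
    rw [max_eq_left hpos.le] at this
    exact (mul_pos hpos hpos).ne' this
  refine ⟨hle, ?_⟩
  -- The multiplier 0 shows that the integral of (T_K^*T_K - γ²)Λ is at least 0, while its integrand
  -- is nonpositive.
  have h1 := hmax' (fun _ => 0) (integrable_zero _ _ _) (ae_of_all _ fun _ => le_rfl)
  simp only [mul_zero, integral_zero] at h1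
  have hnp : ∀ᵐ ω ∂dFreq, (S.gram K ω - γ ^ 2) * Λ ω ≤ 0 := by
    filter_upwards [hle, hΛ0] with ω h2 h3
    exact mul_nonpos_of_nonpos_of_nonneg (sub_nonpos.2 h2) h3
  have h4 : ∫ ω, -((S.gram K ω - γ ^ 2) * Λ ω) ∂dFreq = 0 := by
    refine le_antisymm ?_ (integral_nonneg_of_ae ?_)
    · rw [integral_neg]
      linarith
    · filter_upwards [hnp] with ω hω using neg_nonneg.2 hω
  have hneg : Integrable (fun ω => -((S.gram K ω - γ ^ 2) * Λ ω)) dFreq := (hDmul hΛ).neg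
  rw [integral_eq_zero_iff_of_nonneg_ae
    (by filter_upwards [hnp] with ω hω using neg_nonneg.2 hω) hneg] at h4
  filter_upwards [h4] with ω hω using neg_eq_zero.1 hω

theorem lagrangian_le_sqNormH2 (hF : MemHardyMat ∞ S.F) (hG : MemHardyMat ∞ S.G) {γ : ℝ}
    {K : Freq → Fin du → ℂ} {Λ : Freq → ℝ} (hK : MemHardyVec ∞ K)
    (hle : ∀ᵐ ω ∂dFreq, S.gram K ω ≤ γ ^ 2) (hΛ : Integrable Λ dFreq)
    (hΛ0 : ∀ᵐ ω ∂dFreq, 0 ≤ Λ ω) : S.lagrangian γ K Λ ≤ S.sqNormH2 K := by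
  rw [lagrangian_eq hF hG hK γ hΛ, add_le_iff_nonpos_right]
  refine integral_nonpos_of_ae ?_
  filter_upwards [hle, hΛ0] with ω h2 h3
  exact mul_nonpos_of_nonpos_of_nonneg (sub_nonpos.2 h2) h3

theorem IsSaddlePoint.lagrangian_eq_sqNormH2 (hF : MemHardyMat ∞ S.F) (hG : MemHardyMat ∞ S.G)
    {γ : ℝ} {K : Freq → Fin du → ℂ} {Λ : Freq → ℝ} (h : S.IsSaddlePoint γ K Λ) :
    S.lagrangian γ K Λ = S.sqNormH2 K := by
  rw [lagrangian_eq hF hG h.1 γ h.2.1, add_eq_left]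
  rw [integral_congr_ae (h.ae_slack hF hG).2, integral_zero]

theorem IsSaddlePoint.isMixedOptimal (hF : MemHardyMat ∞ S.F) (hG : MemHardyMat ∞ S.G)
    {γ : ℝ} (hγ : 0 ≤ γ) {K : Freq → Fin du → ℂ} {Λ : Freq → ℝ} (h : S.IsSaddlePoint γ K Λ) :
    S.IsMixedOptimal γ K := by
  refine ⟨h.1, (normHInf_le_iff hγ K).2 (h.ae_slack hF hG).1, fun K' hK' hle => ?_⟩
  rw [← h.lagrangian_eq_sqNormH2 hF hG]
  exact (h.2.2.2.1 K' hK').trans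
    (lagrangian_le_sqNormH2 hF hG hK' ((normHInf_le_iff hγ K').1 hle) h.2.1 h.2.2.1)

/-- Every solution of the mixed problem minimises the Lagrangian of a saddle point. -/
theorem IsSaddlePoint.lagrangian_le_of_isMixedOptimal (hF : MemHardyMat ∞ S.F)
    (hG : MemHardyMat ∞ S.G) {γ : ℝ} (hγ : 0 ≤ γ) {K K₁ : Freq → Fin du → ℂ} {Λ : Freq → ℝ}
    (h : S.IsSaddlePoint γ K Λ) (h₁ : S.IsMixedOptimal γ K₁) {K' : Freq → Fin du → ℂ}
    (hK' : MemHardyVec ∞ K') : S.lagrangian γ K₁ Λ ≤ S.lagrangian γ K' Λ := by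
  have hle := lagrangian_le_sqNormH2 hF hG h₁.1 ((normHInf_le_iff hγ K₁).1 h₁.2.1) h.2.1 h.2.2.1
  have hopt := h₁.2.2 K h.1 ((normHInf_le_iff hγ K).2 (h.ae_slack hF hG).1)
  rw [← h.lagrangian_eq_sqNormH2 hF hG] at hopt
  exact (hle.trans hopt).trans (h.2.2.2.1 K' hK')

end LQSystem

/-! ### First order optimality and the formula for minimisers. -/

theorem eq_zero_of_forall_quadratic_nonneg {X Y : ℝ} (h : ∀ t : ℝ, 0 ≤ 2 * t * X + t ^ 2 * Y) :
    X = 0 := by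
  have h1 := discrim_le_zero (a := Y) (b := 2 * X) (c := 0) fun t => by
    have := h t
    linarith
  rw [discrim] at h1
  nlinarith [sq_nonneg X]

theorem norm_add_smul_single_sq {n : ℕ} (e : Fin n → ℂ) (i : Fin n) (c : ℂ) (t : ℝ) :
    ∑ k, ‖(e + ((t : ℂ) * c) • (Pi.single i 1 : Fin n → ℂ)) k‖ ^ 2 =
      (∑ k, ‖e k‖ ^ 2) + 2 * t * (star c * e i).re + t ^ 2 * ‖c‖ ^ 2 := by
  have h1 : ∀ k, ‖(e + ((t : ℂ) * c) • (Pi.single i 1 : Fin n → ℂ)) k‖ ^ 2 =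
      ‖e k‖ ^ 2 + if k = i then 2 * t * (star c * e i).re + t ^ 2 * ‖c‖ ^ 2 else 0 := by
    intro k
    simp only [Pi.add_apply, Pi.smul_apply, smul_eq_mul]
    split_ifs with hk
    · subst hk
      rw [Pi.single_eq_same, mul_one, ← Complex.normSq_eq_norm_sq, ← Complex.normSq_eq_norm_sq,
        ← Complex.normSq_eq_norm_sq, Complex.normSq_apply, Complex.normSq_apply,
        Complex.normSq_apply, RCLike.star_def]
      simp only [Complex.add_re, Complex.add_im, Complex.mul_re, Complex.mul_im,
        Complex.ofReal_re, Complex.ofReal_im, Complex.conj_re, Complex.conj_im]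
      ring
    · rw [Pi.single_eq_of_ne hk, mul_zero, add_zero, add_zero]
  simp only [h1, Finset.sum_add_distrib, Finset.sum_ite_eq', Finset.mem_univ, if_true]
  ring

namespace LQSystem

variable {dx du : ℕ} {S : LQSystem dx du} {P : Matrix (Fin dx) (Fin dx) ℝ}
  {Δ : Freq → Matrix (Fin du) (Fin du) ℂ}

/-- First order optimality: if `K` minimises the Lagrangian, then `Δ (K - K_∘) L` is orthogonal to
the functions `z^{-n} L e_i`, `n ≥ 0`. -/
theorem IsCanonicalFactor.integral_eq_zero_of_minimizer (hΔ : S.IsCanonicalFactor Δ)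
    (hP : S.IsStabilizingRiccati P) (hF : MemHardyMat ∞ S.F) (hG : MemHardyMat ∞ S.G) {γ : ℝ}
    {K : Freq → Fin du → ℂ} (hK : MemHardyVec ∞ K) {Λ : Freq → ℝ} (hΛ : Integrable Λ dFreq)
    (hmin : ∀ K' : Freq → Fin du → ℂ, MemHardyVec ∞ K' →
      S.lagrangian γ K Λ ≤ S.lagrangian γ K' Λ) (n : ℕ) (i : Fin du) :
    ∫ ω, fourier n ω * (Δ ω *ᵥ (K ω - S.Knc ω)) i * ((1 + Λ ω : ℝ) : ℂ) ∂dFreq = 0 := by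
  set e : Freq → Fin du → ℂ := fun ω => Δ ω *ᵥ (K ω - S.Knc ω) with he
  have hN : Integrable (fun ω => 1 + Λ ω) dFreq := (integrable_const 1).add hΛ
  have heL : MemLp (fun ω => e ω i) ∞ dFreq := by
    simp only [he, Matrix.mulVec_sub]
    exact (hΔ.1.mulVec hK i).1.sub (hΔ.memLp_mulVec_Knc hP hF hG i)
  set w : Freq → ℂ := fun ω => fourier n ω * e ω i with hw
  have hwL : MemLp w ∞ dFreq := (memLp_fourier n ∞).mul_top heL
  have hwN : Integrable (fun ω => w ω * ((1 + Λ ω : ℝ) : ℂ)) dFreq :=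
    (memLp_one_iff_integrable.2 hN.ofReal).mul (r := 1) hwL |> memLp_one_iff_integrable.1
  have hvar : ∀ c : ℂ, ‖c‖ = 1 → ∫ ω, (star c * w ω).re * (1 + Λ ω) ∂dFreq = 0 := by
    intro c hc
    refine eq_zero_of_forall_quadratic_nonneg (Y := ∫ ω, (1 + Λ ω) ∂dFreq) fun t => ?_
    -- Causal because Δ⁻¹ ∈ H_∞; multiplication by Δ turns the perturbation into t c z^{-n}e_i, so
    -- the cost is an exact quadratic in t.
    set K' : Freq → Fin du → ℂ := fun ω => K ω +
      (Δ ω)⁻¹ *ᵥ (((t : ℂ) * (c * fourier (-(n : ℤ)) ω)) • Pi.single i 1) with hK'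
    have hK'H : MemHardyVec ∞ K' := by
      intro k
      refine (hK k).add le_top (hΔ.2.1.mulVec (fun j => ?_) k)
      have := (memHardy_fourier_neg n ∞).const_mul ((t : ℂ) * c * (Pi.single i 1 : Fin du → ℂ) j)
      refine this.congr (ae_of_all _ fun ω => ?_)
      simp only [Pi.smul_apply, smul_eq_mul]
      ring
    have hgram : ∀ᵐ ω ∂dFreq, S.gram K' ω * (1 + Λ ω) = S.gram K ω * (1 + Λ ω) +
        (2 * t * ((star c * w ω).re * (1 + Λ ω)) + t ^ 2 * (1 + Λ ω)) := by
      filter_upwards [hΔ.2.2.1] with ω hω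
      have h1 : Δ ω *ᵥ (K' ω - S.Knc ω) =
          e ω + ((t : ℂ) * (c * fourier (-(n : ℤ)) ω)) • Pi.single i 1 := by
        rw [hK', add_sub_right_comm, Matrix.mulVec_add, Matrix.mulVec_mulVec,
          Matrix.mul_nonsing_inv _ ((Matrix.isUnit_iff_isUnit_det _).1 (isUnit_of_gram hω)),
          Matrix.one_mulVec]
      have h2 : Δ ω *ᵥ (K ω - S.Knc ω) = e ω := rfl
      rw [gram_eq_gram_Knc_add hω (K := K'), gram_eq_gram_Knc_add hω (K := K), h1, h2,
        norm_add_smul_single_sq, norm_mul, hc, norm_fourier_apply, star_mul', star_fourier,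
        neg_neg, hw, mul_assoc]
      ring_nf
    have hX : Integrable (fun ω => (star c * w ω).re * (1 + Λ ω)) dFreq := by
      refine ((hwN.const_mul (star c)).re).congr (ae_of_all _ fun ω => ?_)
      simp only [← mul_assoc, RCLike.re_eq_complex_re, Complex.re_mul_ofReal]
    have hgN : Integrable (fun ω => S.gram K ω * (1 + Λ ω)) dFreq :=
      (memLp_one_iff_integrable.2 hN).mul (r := 1) (memLp_gram hF hG hK) |>
        memLp_one_iff_integrable.1
    have hsum : Integrable (fun ω => 2 * t * ((star c * w ω).re * (1 + Λ ω)) +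
        t ^ 2 * (1 + Λ ω)) dFreq := (hX.const_mul _).add (hN.const_mul _)
    have h2 := hmin K' hK'H
    unfold lagrangian at h2
    rw [integral_congr_ae hgram, integral_add hgN hsum,
      integral_add (hX.const_mul _) (hN.const_mul _), integral_const_mul, integral_const_mul] at h2
    linarith
  -- The directions c = 1 and c = i yield the real and the imaginary part.
  have hre := hvar 1 norm_one
  have him := hvar Complex.I Complex.norm_I
  have key : ∀ c : ℂ, ∫ ω, (star c * w ω).re * (1 + Λ ω) ∂dFreq =
      (star c * ∫ ω, w ω * ((1 + Λ ω : ℝ) : ℂ) ∂dFreq).re := by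
    intro c
    rw [← integral_const_mul, ← RCLike.re_eq_complex_re, ← integral_re (hwN.const_mul _)]
    refine integral_congr_ae (ae_of_all _ fun ω => ?_)
    simp only [← mul_assoc, RCLike.re_eq_complex_re, Complex.re_mul_ofReal]
  rw [key] at hre him
  change ∫ ω, w ω * ((1 + Λ ω : ℝ) : ℂ) ∂dFreq = 0
  generalize ∫ ω, w ω * ((1 + Λ ω : ℝ) : ℂ) ∂dFreq = x at hre him
  refine Complex.ext ?_ ?_
  · simpa using hre
  · simpa using him

theorem ae_ne_zero_of_isSpectralFactor {Λ : Freq → ℝ} {L : Freq → ℂ}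
    (hΛ0 : ∀ᵐ ω ∂dFreq, 0 ≤ Λ ω) (hL : IsSpectralFactor (fun ω => 1 + Λ ω) L) :
    ∀ᵐ ω ∂dFreq, L ω ≠ 0 := by
  filter_upwards [hΛ0, hL.2.2] with ω h0 h1 h2
  rw [h2, zero_mul] at h1
  have h3 : (0 : ℝ) = 1 + Λ ω := by exact_mod_cast h1
  linarith

/-- A minimiser `K` of the Lagrangian satisfies `Δ (K - K_∘) L = -{Δ K_∘ L}_-`. -/
theorem IsCanonicalFactor.ae_Sminus_eq_of_minimizer (hΔ : S.IsCanonicalFactor Δ)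
    (hP : S.IsStabilizingRiccati P) (hF : MemHardyMat ∞ S.F) (hG : MemHardyMat ∞ S.G) {γ : ℝ}
    {K : Freq → Fin du → ℂ} (hK : MemHardyVec ∞ K) {Λ : Freq → ℝ} (hΛ : Integrable Λ dFreq)
    (hΛ0 : ∀ᵐ ω ∂dFreq, 0 ≤ Λ ω)
    (hmin : ∀ K' : Freq → Fin du → ℂ, MemHardyVec ∞ K' →
      S.lagrangian γ K Λ ≤ S.lagrangian γ K' Λ) {L : Freq → ℂ}
    (hL : IsSpectralFactor (fun ω => 1 + Λ ω) L) :
    ∀ᵐ ω ∂dFreq, S.Sminus Δ L ω = -(L ω • (Δ ω *ᵥ (K ω - S.Knc ω))) := by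
  have hall : ∀ᵐ ω ∂dFreq, ∀ i, S.Sminus Δ L ω i = -(L ω • (Δ ω *ᵥ (K ω - S.Knc ω))) i := by
    rw [ae_all_iff]
    intro i
    have h1 : MemHardy 2 (fun ω => (Δ ω *ᵥ K ω) i * L ω) := (hΔ.1.mulVec hK i).mul_two hL.1
    have h2 : MemLp (fun ω => (L ω • (Δ ω *ᵥ S.Knc ω)) i) 2 dFreq := by
      refine ((hΔ.memLp_mulVec_Knc hP hF hG i).mul_top hL.1.1).ae_eq (ae_of_all _ fun ω => ?_)
      simp only [Pi.smul_apply, smul_eq_mul, mul_comm]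
    have hE : (fun ω => -(L ω • (Δ ω *ᵥ (K ω - S.Knc ω))) i) =
        fun ω => (L ω • (Δ ω *ᵥ S.Knc ω)) i - (Δ ω *ᵥ K ω) i * L ω := by
      funext ω
      simp only [Matrix.mulVec_sub, Pi.smul_apply, Pi.sub_apply, smul_eq_mul]
      ring
    -- The residual differs from LΔK_∘ by LΔK ∈ H₂, so the coefficients of positive index agree;
    -- orthogonality to the z^{-n}L removes the others.
    refine anticausalPart_ae_eq (g := fun ω => -(L ω • (Δ ω *ᵥ (K ω - S.Knc ω))) i) ?_
      (fun m hm => ?_) (fun m hm => ?_)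
    · rw [hE]
      exact h2.sub h1.1
    · rw [hE, fourierCoeff_sub h2.integrable_two h1.1.integrable_two, h1.2 m hm, sub_zero]
    · refine fourierCoeff_eq_zero_of_orthogonal hL.1 hL.2.1
        (ae_ne_zero_of_isSpectralFactor hΛ0 hL) ?_ (fun n => ?_) hm
      · rw [hE]
        exact h2.sub h1.1
      -- The weight 1 + Λ = LL^* gives one factor to the test function and the other to the
      -- residual.
      · rw [← neg_eq_zero, ← integral_neg,
          ← hΔ.integral_eq_zero_of_minimizer hP hF hG hK hΛ hmin n i]
        refine integral_congr_ae ?_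
        filter_upwards [hL.2.2] with ω hω
        rw [← hω]
        simp only [star_mul', star_fourier, neg_neg, Pi.smul_apply, smul_eq_mul]
        ring
  filter_upwards [hall] with ω hω
  funext i
  exact hω i

/-- The formula for a minimiser of the Lagrangian. -/
theorem IsCanonicalFactor.ae_eq_of_minimizer (hΔ : S.IsCanonicalFactor Δ)
    (hP : S.IsStabilizingRiccati P) (hF : MemHardyMat ∞ S.F) (hG : MemHardyMat ∞ S.G) {γ : ℝ}
    {K : Freq → Fin du → ℂ} (hK : MemHardyVec ∞ K) {Λ : Freq → ℝ} (hΛ : Integrable Λ dFreq)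
    (hΛ0 : ∀ᵐ ω ∂dFreq, 0 ≤ Λ ω)
    (hmin : ∀ K' : Freq → Fin du → ℂ, MemHardyVec ∞ K' →
      S.lagrangian γ K Λ ≤ S.lagrangian γ K' Λ) {L : Freq → ℂ}
    (hL : IsSpectralFactor (fun ω => 1 + Λ ω) L) :
    ∀ᵐ ω ∂dFreq, K ω = S.Knc ω - (L ω)⁻¹ • ((Δ ω)⁻¹ *ᵥ S.Sminus Δ L ω) := by
  filter_upwards [hΔ.ae_Sminus_eq_of_minimizer hP hF hG hK hΛ hΛ0 hmin hL,
    ae_ne_zero_of_isSpectralFactor hΛ0 hL, hΔ.2.2.1] with ω h1 h2 h3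
  rw [h1, Matrix.mulVec_neg, Matrix.mulVec_smul, smul_neg, smul_smul, inv_mul_cancel₀ h2, one_smul,
    Matrix.mulVec_mulVec, Matrix.nonsing_inv_mul _
      ((Matrix.isUnit_iff_isUnit_det _).1 (isUnit_of_gram h3)), Matrix.one_mulVec]
  abel

/-- The scalar maximum formula at one frequency: `d = γ² - |T_{K_∘}|² > 0`, `s = |Δ (K - K_∘)|²`. -/
theorem one_add_eq_max_of_slack {d s l : ℝ} (hd : 0 < d) (hs : s ≤ d) (hl : 0 ≤ l)
    (h : (s - d) * l = 0) : 1 + l = max (s * (1 + l) / d) 1 := by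
  rcases mul_eq_zero.1 h with h | h
  · rw [sub_eq_zero.1 h, mul_div_cancel_left₀ _ hd.ne', max_eq_left (by linarith)]
  · rw [h, add_zero, mul_one, max_eq_right ((div_le_one hd).2 hs)]

end LQSystem

/-! ### The main theorem. -/

theorem theorem3 {dx du : ℕ} (sys : LQSystem dx du)
    (hAu : IsStabilizable sys.A sys.Bu) (hAw : IsStabilizable sys.A sys.Bw)
    (hF : MemHardyMat ∞ sys.F) (hG : MemHardyMat ∞ sys.G)
    (P : Matrix (Fin dx) (Fin dx) ℝ) (hP : sys.IsStabilizingRiccati P)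
    (Δ : Freq → Matrix (Fin du) (Fin du) ℂ) (hΔ : sys.IsCanonicalFactor Δ)
    (γ : ℝ) (hγ : sys.gammaInf < ENNReal.ofReal γ)
    (Kγ : Freq → Fin du → ℂ) (Λγ : Freq → ℝ) (hsaddle : sys.IsSaddlePoint γ Kγ Λγ)
    (Lγ : Freq → ℂ) (hL : IsSpectralFactor (fun ω => 1 + Λγ ω) Lγ) :
    -- the state-space form of the strictly anticausal term
    (∀ᵐ ω ∂dFreq, sys.Sminus Δ Lγ ω =
      toC (sys.Cbar P) *ᵥ
        (((expj ω)⁻¹ • (1 : Matrix (Fin dx) (Fin dx) ℂ) - toC (sys.Abar P))⁻¹ *ᵥ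
          sys.Bbar P Lγ)) ∧
    -- the optimal controller
    sys.IsMixedOptimal γ Kγ ∧
    (∀ᵐ ω ∂dFreq, Kγ ω = sys.Knc ω - (Lγ ω)⁻¹ • ((Δ ω)⁻¹ *ᵥ sys.Sminus Δ Lγ ω)) ∧
    (∀ K : Freq → Fin du → ℂ, sys.IsMixedOptimal γ K → K =ᵐ[dFreq] Kγ) ∧
    -- the scalar maximum formula, with a positive denominator
    (∀ᵐ ω ∂dFreq, sys.gram sys.Knc ω < γ ^ 2) ∧
    (∀ᵐ ω ∂dFreq, star (Lγ ω) * Lγ ω =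
      ((max ((star (sys.Sminus Δ Lγ ω) ⬝ᵥ sys.Sminus Δ Lγ ω).re
          / (γ ^ 2 - sys.gram sys.Knc ω)) 1 : ℝ) : ℂ)) := by
  have hγ0 : 0 ≤ γ := (ENNReal.ofReal_pos.1 (bot_le.trans_lt hγ)).le
  obtain ⟨hle, hslack⟩ := hsaddle.ae_slack hF hG
  have hlt := LQSystem.ae_gram_Knc_lt hΔ hγ
  refine ⟨hΔ.ae_Sminus_eq hP hF hG hL.1, hsaddle.isMixedOptimal hF hG hγ0,
    hΔ.ae_eq_of_minimizer hP hF hG hsaddle.1 hsaddle.2.1 hsaddle.2.2.1 hsaddle.2.2.2.1 hL,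
    fun K hK => ?_, hlt, ?_⟩
  -- Any other optimal controller minimises the Lagrangian with the same multiplier, so the same
  -- explicit formula applies to it.
  · filter_upwards [hΔ.ae_eq_of_minimizer hP hF hG hK.1 hsaddle.2.1 hsaddle.2.2.1
        (fun K' hK' => hsaddle.lagrangian_le_of_isMixedOptimal hF hG hγ0 hK hK') hL,
      hΔ.ae_eq_of_minimizer hP hF hG hsaddle.1 hsaddle.2.1 hsaddle.2.2.1 hsaddle.2.2.2.1 hL]
      with ω h1 h2
    rw [h1, h2]
  · filter_upwards [hΔ.ae_Sminus_eq_of_minimizer hP hF hG hsaddle.1 hsaddle.2.1 hsaddle.2.2.1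
      hsaddle.2.2.2.1 hL, hΔ.2.2.1, hle, hslack, hlt, hsaddle.2.2.1, hL.2.2]
      with ω h1 h2 h3 h4 h5 h6 h7
    -- Feasibility and slackness become s ≤ d and (s - d)Λ = 0, with s = |Δ(K_γ - K_∘)|² and d = γ²
    -- - T_{K_∘}^*T_{K_∘} > 0.
    rw [LQSystem.gram_eq_gram_Knc_add h2] at h3 h4
    have h8 : ‖Lγ ω‖ ^ 2 = 1 + Λγ ω := by
      rw [RCLike.star_def, Complex.mul_conj'] at h7
      exact_mod_cast h7
    have h9 : (star (sys.Sminus Δ Lγ ω) ⬝ᵥ sys.Sminus Δ Lγ ω).re =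
        (∑ i, ‖(Δ ω *ᵥ (Kγ ω - sys.Knc ω)) i‖ ^ 2) * (1 + Λγ ω) := by
      rw [h1, re_star_dotProduct_self, Finset.sum_mul, ← h8]
      refine Finset.sum_congr rfl fun i _ => ?_
      rw [Pi.neg_apply, norm_neg, Pi.smul_apply, smul_eq_mul, norm_mul]
      ring
    rw [mul_comm, h7, h9, ← LQSystem.one_add_eq_max_of_slack (sub_pos.2 h5) (by linarith) h6
      (by rw [← h4]; ring)]
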